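/- Let $\Lambda$ be a finite dimensional algebra of finite global dimension over a field, let $\mathrm{mod}\,\Lambda$ be the category of finitely generated right $\Lambda$-modules, let $\Sigma$ be the shift functor of the bounded derived category $D^b(\mathrm{mod}\,\Lambda)$, and let $n\ge 1$ be an integer. The orbit category $D^b(\mathrm{mod}\,\Lambda)/\Sigma^n$ has the objects of $D^b(\mathrm{mod}\,\Lambda)$, morphism groups $\bigoplus_{i\in\mathbb Z}\mathrm{Hom}_{D^b(\mathrm{mod}\,\Lambda)}(X,\Sigma^{ni}Y)$, and the composite of $f\colon X\to\Sigma^{ni}Y$ with $g\colon Y\to\Sigma^{nj}Z$ is $\Sigma^{ni}g\circ f$. Let $D_n(\mathrm{mod}\,\Lambda)$ be the $n$-periodic derived category, i.e. the localization at the quasi-isomorphisms of the homotopy category of $n$-periodic complexes in $\mathrm{mod}\,\Lambda$; an $n$-periodic complex consists of modules $M^r$, $r\in\mathbb Z/n$, and differentials $M^r\to M^{r+1}$ of square zero (for $n=1$: a module with an endomorphism of square zero). The compression $\Delta X$ of a bounded complex $X$ is the $n$-periodic complex with $(\Delta X)^r=\bigoplus_{i\equiv r\,(n)}X^i$ and the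 differential given by that of $X$; an object of $D_n(\mathrm{mod}\,\Lambda)$ is called gradable if it is isomorphic to $\Delta X$ for some bounded complex $X$ in $\mathrm{mod}\,\Lambda$. Then compression of complexes induces a fully faithful functor $$\Delta\colon D^b(\mathrm{mod}\,\Lambda)/\Sigma^n\longrightarrow D_n(\mathrm{mod}\,\Lambda).$$ That is, there is a fully faithful functor between these categories which on bounded complexes and chain maps agrees, up to natural isomorphism, with compression, and which sends the degree-one morphism $\Sigma^nX\to X$ of the orbit category given by $1_{\Sigma^nX}$ to the canonical isomorphism $\Delta(\Sigma^nX)\cong\Delta X$, which is $(-1)^{nj}$ on the summand $(\Sigma^nX)^j=X^{j+n}$. It induces an equivalence between the orbit category $D^b(\mathrm{mod}\,\Lambda)/\Sigma^n$ and the full subcategory of gradable objects of $D_n(\mathrm{mod}\,\Lambda)$. In particular, for $n=1$, this holds for $D^b(\mathrm{mod}\,\Lambda)/\Sigma\to D_1(\mathrm{mod}\,\Lambda)$. -/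

import Mathlib

open CategoryTheory CategoryTheory.Limits
open scoped DirectSum

universe v u

/-! ### Orbit categories -/

/-- The orbit category `T/Σⁿ` of a category `T` with shift functors `Σ^m = (-)⟦m⟧`, `m : ℤ`:
it has the same objects as `T`. -/
@[ext]
structure OrbitCategory (T : Type u) (n : ℕ) where
  /-- the underlying object of `T` -/
  obj : T

namespace OrbitCategory

variable {T : Type u} [Category.{v} T] [Preadditive T] [HasShift T ℤ]

/-- The morphisms `X ⟶ Y` in `T/Σⁿ` are the elements of `⨁_{i ∈ ℤ} T(X, Σ^{ni} Y)`. -/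
abbrev OrbitHom (n : ℕ) (X Y : T) : Type v :=
  ⨁ i : ℤ, ShiftedHom X Y ((n : ℤ) * i)

variable {n : ℕ}

lemma of_comp_congr {X Y Z : T} {a b : ℤ} (f : ShiftedHom X Y a) (g : ShiftedHom Y Z b)
    {i j : ℤ} (hij : i = j) (hi : b + a = (n : ℤ) * i) (hj : b + a = (n : ℤ) * j) :
    DirectSum.of (fun i : ℤ => ShiftedHom X Z ((n : ℤ) * i)) i (f.comp g hi) =
      DirectSum.of (fun i : ℤ => ShiftedHom X Z ((n : ℤ) * i)) j (f.comp g hj) := by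
  subst hij
  rfl

variable [∀ m : ℤ, (shiftFunctor T m).Additive]

/-- The composition `(f, g) ↦ Σ^{ni} g ∘ f` of `f ∈ T(X, Σ^{ni} Y)` and `g ∈ T(Y, Σ^{nj} Z)`,
extended biadditively. -/
noncomputable def compHom (X Y Z : T) :
    OrbitHom n X Y →+ OrbitHom n Y Z →+ OrbitHom n X Z :=
  DirectSum.toAddMonoid fun i => AddMonoidHom.flip <| DirectSum.toAddMonoid fun j =>
    AddMonoidHom.mk' (fun g => AddMonoidHom.mk'
      (fun f => DirectSum.of (fun i : ℤ => ShiftedHom X Z ((n : ℤ) * i)) (i + j)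
        (ShiftedHom.comp f g (by ring)))
      (fun f f' => by rw [ShiftedHom.add_comp, map_add]))
      (fun g g' => by
        ext f
        simp only [AddMonoidHom.mk'_apply, AddMonoidHom.add_apply]
        rw [ShiftedHom.comp_add, map_add])

lemma compHom_of_of {X Y Z : T} (i j : ℤ) (f : ShiftedHom X Y ((n : ℤ) * i))
    (g : ShiftedHom Y Z ((n : ℤ) * j)) :
    compHom X Y Z (DirectSum.of _ i f) (DirectSum.of _ j g) =
      DirectSum.of (fun i : ℤ => ShiftedHom X Z ((n : ℤ) * i)) (i + j)
        (f.comp g (by ring)) := by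
  simp [compHom]

noncomputable instance : Category.{v} (OrbitCategory T n) where
  Hom X Y := OrbitHom n X.obj Y.obj
  id X := DirectSum.of (fun i : ℤ => ShiftedHom X.obj X.obj ((n : ℤ) * i)) 0
    (ShiftedHom.mk₀ _ (mul_zero _) (𝟙 X.obj))
  comp f g := compHom _ _ _ f g
  id_comp {X Y} f := by
    induction f using DirectSum.induction_on with
    | zero => simp
    | of i f =>
      rw [compHom_of_of, of_comp_congr (j := i) _ _ (zero_add i) _ (by ring),
        ShiftedHom.mk₀_id_comp]
    | add f g hf hg => rw [map_add, hf, hg]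
  comp_id {X Y} f := by
    induction f using DirectSum.induction_on with
    | zero => simp
    | of i f =>
      rw [compHom_of_of, of_comp_congr (j := i) _ _ (add_zero i) _ (by ring),
        ShiftedHom.comp_mk₀_id]
    | add f g hf hg => rw [map_add, AddMonoidHom.add_apply, hf, hg]
  assoc {X Y Z W} f g h := by
    induction f using DirectSum.induction_on with
    | zero => simp
    | add f f' hf hf' => simp only [map_add, AddMonoidHom.add_apply, hf, hf']
    | of i f =>
      induction g using DirectSum.induction_on with
      | zero => simp
      | add g g' hg hg' => simp only [map_add, AddMonoidHom.add_apply, hg, hg']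
      | of j g =>
        induction h using DirectSum.induction_on with
        | zero => simp
        | add h h' hh hh' => simp only [map_add, hh, hh']
        | of l h =>
          simp only [compHom_of_of]
          rw [of_comp_congr _ _ (add_assoc i j l) _ (by ring),
            ShiftedHom.comp_assoc _ _ _ (a₂₃ := (n : ℤ) * (j + l)) _ (by ring) (by ring)]

variable (T n) in
/-- The canonical functor `T ⥤ T/Σⁿ`. -/
noncomputable def proj : T ⥤ OrbitCategory T n where
  obj X := ⟨X⟩
  map {X Y} f := DirectSum.of (fun i : ℤ => ShiftedHom X Y ((n : ℤ) * i)) 0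
    (ShiftedHom.mk₀ _ (mul_zero _) f)
  map_id X := rfl
  map_comp {X Y Z} f g := by
    change _ = compHom _ _ _ _ _
    rw [compHom_of_of, of_comp_congr (j := 0) _ _ (zero_add 0) _ (by ring),
      ShiftedHom.mk₀_comp_mk₀]

/-- A morphism `f : X ⟶ Σⁿ Y` of `T`, viewed as a morphism `X ⟶ Y` of `T/Σⁿ`, homogeneous of
degree `1` with respect to the decomposition of the morphism spaces. -/
noncomputable def homOfDegreeOne {X Y : T} (f : X ⟶ Y⟦(n : ℤ)⟧) :
    (proj T n).obj X ⟶ (proj T n).obj Y :=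
  DirectSum.of (fun i : ℤ => ShiftedHom X Y ((n : ℤ) * i)) 1
    (f ≫ eqToHom (by rw [mul_one]))

end OrbitCategory

/-! ### Bounded complexes, and the compression functor -/

section Compression

variable (R : Type u) [Ring R]

/-- The property of being a bounded complex of finitely generated modules. -/
def boundedComplexes : ObjectProperty (CochainComplex (FGModuleCat.{v} R) ℤ) :=
  fun X => ∃ a b : ℤ, X.IsStrictlyGE a ∧ X.IsStrictlyLE b

/-- The category `C^b(mod R)` of bounded cochain complexes of finitely generated `R`-modules. -/
abbrev Cb := (boundedComplexes.{v} R).FullSubcategory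

variable {R}

/-- The shift `Σ^m X` of a bounded complex `X`. -/
noncomputable def Cb.shift (X : Cb.{v} R) (m : ℤ) : Cb.{v} R :=
  ⟨X.obj⟦m⟧, by
    obtain ⟨a, b, _, _⟩ := X.property
    exact ⟨a - m, b - m, X.obj.isStrictlyGE_shift a m _ (by ring),
      X.obj.isStrictlyLE_shift b m _ (by ring)⟩⟩

/-- The module `⨁_{j ≡ r (n)} X^j`. -/
abbrev compressionModule (n : ℕ) (X : CochainComplex (FGModuleCat.{v} R) ℤ) (r : ZMod n) :
    Type v :=
  ⨁ j : {j : ℤ // (j : ZMod n) = r}, X.X j.1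

lemma compressionModule_finite (n : ℕ) (X : Cb.{v} R) (r : ZMod n) :
    Module.Finite R (compressionModule n X.obj r) := by
  obtain ⟨a, b, _, _⟩ := X.property
  have hfin : Set.Finite {j : {j : ℤ // (j : ZMod n) = r} | a ≤ j.1 ∧ j.1 ≤ b} :=
    Set.Finite.preimage Subtype.val_injective.injOn (Set.finite_Icc a b)
  have htop : (⊤ : Submodule R (compressionModule n X.obj r)) =
      ⨆ j ∈ hfin.toFinset, LinearMap.range
        (DirectSum.lof R {j : ℤ // (j : ZMod n) = r} (fun j => X.obj.X j.1) j) := by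
    refine le_antisymm (fun x _ => ?_) le_top
    induction x using DirectSum.induction_on with
    | zero => exact zero_mem _
    | add x y hx hy => exact add_mem (hx trivial) (hy trivial)
    | of j x =>
      by_cases hj : a ≤ j.1 ∧ j.1 ≤ b
      · exact Submodule.mem_iSup_of_mem j (Submodule.mem_iSup_of_mem (by simpa using hj) ⟨x, rfl⟩)
      · have hz : IsZero (X.obj.X j.1) := by
          rcases not_and_or.1 hj with h | h
          · exact X.obj.isZero_of_isStrictlyGE a j.1 (by omega)
          · exact X.obj.isZero_of_isStrictlyLE b j.1 (by omega)
        have hx : x = 0 := by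
          have := (IsZero.iff_id_eq_zero _).1 hz
          exact congrArg (fun f => f.hom.hom x) this
        rw [hx, map_zero]
        exact zero_mem _
  refine ⟨?_⟩
  rw [htop]
  refine Submodule.fg_biSup _ _ fun j _ => ?_
  rw [LinearMap.range_eq_map]
  exact Submodule.FG.map _ Module.Finite.fg_top

/-- The finitely generated module `(ΔX)^r = ⨁_{j ≡ r (n)} X^j`. -/
noncomputable def compressionX (n : ℕ) (X : Cb.{v} R) (r : ZMod n) : FGModuleCat.{v} R :=
  haveI := compressionModule_finite n X r
  FGModuleCat.of R (compressionModule n X.obj r)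

/-- The inclusion of the direct summand `X^j` in `⨁_{j ≡ r (n)} X^j`. -/
noncomputable def compressionι (n : ℕ) (X : Cb.{v} R) (r : ZMod n) (j : ℤ)
    (hj : (j : ZMod n) = r) : X.obj.X j ⟶ compressionX n X r :=
  ObjectProperty.homMk (ModuleCat.ofHom
    (DirectSum.lof R {j : ℤ // (j : ZMod n) = r} (fun j => X.obj.X j.1) ⟨j, hj⟩))

/-- The morphism on `⨁_{j ≡ r (n)} X^j` with the given restrictions to the summands. -/
noncomputable def compressionDesc {n : ℕ} {X : Cb.{v} R} {r : ZMod n} {M : FGModuleCat.{v} R}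
    (f : ∀ j : ℤ, (j : ZMod n) = r → (X.obj.X j ⟶ M)) : compressionX n X r ⟶ M :=
  ObjectProperty.homMk (ModuleCat.ofHom
    (DirectSum.toModule R {j : ℤ // (j : ZMod n) = r} M (fun j => (f j.1 j.2).hom.hom)))

@[simp]
lemma compressionι_desc {n : ℕ} {X : Cb.{v} R} {r : ZMod n} {M : FGModuleCat.{v} R}
    (f : ∀ j : ℤ, (j : ZMod n) = r → (X.obj.X j ⟶ M)) (j : ℤ) (hj : (j : ZMod n) = r) :
    compressionι n X r j hj ≫ compressionDesc f = f j hj := by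
  apply FGModuleCat.hom_ext
  refine LinearMap.ext fun x => ?_
  exact DirectSum.toModule_lof R (M := fun j : {j : ℤ // (j : ZMod n) = r} => X.obj.X j.1)
    (φ := fun j => (f j.1 j.2).hom.hom) ⟨j, hj⟩ x

lemma compressionι_desc_assoc {n : ℕ} {X : Cb.{v} R} {r : ZMod n} {M N : FGModuleCat.{v} R}
    (f : ∀ j : ℤ, (j : ZMod n) = r → (X.obj.X j ⟶ M)) (j : ℤ) (hj : (j : ZMod n) = r)
    (g : M ⟶ N) :
    compressionι n X r j hj ≫ compressionDesc f ≫ g = f j hj ≫ g := by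
  rw [← Category.assoc, compressionι_desc]

lemma compression_hom_ext {n : ℕ} {X : Cb.{v} R} {r : ZMod n} {M : FGModuleCat.{v} R}
    {f g : compressionX n X r ⟶ M}
    (h : ∀ (j : ℤ) (hj : (j : ZMod n) = r),
      compressionι n X r j hj ≫ f = compressionι n X r j hj ≫ g) : f = g := by
  apply FGModuleCat.hom_ext
  refine DirectSum.linearMap_ext R ?_
  rintro ⟨j, hj⟩
  exact congrArg (fun f => f.hom.hom) (h j hj)

lemma d_compressionι_congr {n : ℕ} (X : Cb.{v} R) {r : ZMod n} {i j j' : ℤ} (h : j = j')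
    (hj : (j : ZMod n) = r) (hj' : (j' : ZMod n) = r) :
    X.obj.d i j ≫ compressionι n X r j hj = X.obj.d i j' ≫ compressionι n X r j' hj' := by
  subst h
  rfl

/-- The category `C_n(A)` of `n`-periodic complexes in `A`: families of objects
indexed by `ℤ/n`, with differentials from the `r`-th to the `(r+1)`-st, of square zero.
In particular, for `n = 1` this is the category of objects of `A` equipped with an endomorphism of
square zero. -/
abbrev PeriodicComplex (A : Type*) [Category* A] [HasZeroMorphisms A] (n : ℕ) :=
  HomologicalComplex A (ComplexShape.up (ZMod n))

lemma cast_add_one {n : ℕ} {r s : ZMod n} (h : r + 1 = s) {j : ℤ} (hj : (j : ZMod n) = r) :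
    ((j + 1 : ℤ) : ZMod n) = s := by
  rw [← h, ← hj, Int.cast_add, Int.cast_one]

open scoped Classical in
/-- The differential `⨁_{j ≡ r (n)} X^j → ⨁_{j ≡ s (n)} X^j` of the compression; for `s = r + 1`
it is given by the differentials `X^j → X^{j+1}` of `X`. -/
noncomputable def compressionD (n : ℕ) (X : Cb.{v} R) (r s : ZMod n) :
    compressionX n X r ⟶ compressionX n X s :=
  if h : r + 1 = s then
    compressionDesc fun j hj =>
      X.obj.d j (j + 1) ≫ compressionι n X s (j + 1) (cast_add_one h hj)
  else 0

lemma compressionι_d {n : ℕ} (X : Cb.{v} R) (r s : ZMod n) (h : r + 1 = s) (j : ℤ)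
    (hj : (j : ZMod n) = r) :
    compressionι n X r j hj ≫ compressionD n X r s =
      X.obj.d j (j + 1) ≫ compressionι n X s (j + 1) (cast_add_one h hj) := by
  rw [compressionD, dif_pos h, compressionι_desc]

lemma compressionι_d_assoc {n : ℕ} (X : Cb.{v} R) (r s : ZMod n) (h : r + 1 = s) (j : ℤ)
    (hj : (j : ZMod n) = r) {M : FGModuleCat.{v} R} (g : compressionX n X s ⟶ M) :
    compressionι n X r j hj ≫ compressionD n X r s ≫ g =
      X.obj.d j (j + 1) ≫ compressionι n X s (j + 1) (cast_add_one h hj) ≫ g := by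
  rw [← Category.assoc, compressionι_d X r s h, Category.assoc]

/-- The compression `ΔX` of a bounded complex `X`: the `n`-periodic complex
`⋯ → ⨁_{j ≡ r (n)} X^j → ⨁_{j ≡ r + 1 (n)} X^j → ⋯`. -/
noncomputable def compressionObj (n : ℕ) (X : Cb.{v} R) :
    PeriodicComplex (FGModuleCat.{v} R) n where
  X r := compressionX n X r
  d r s := compressionD n X r s
  shape r s h := dif_neg h
  d_comp_d' r s t hrs hst := by
    refine compression_hom_ext fun j hj => ?_
    rw [compressionι_d_assoc X r s hrs, compressionι_d X s t hst,
      HomologicalComplex.d_comp_d_assoc, zero_comp, comp_zero]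

/-- The direct sum `⨁_{j ≡ r (n)} X^j ⟶ ⨁_{j ≡ r (n)} Y^j` of the components of a chain map. -/
noncomputable def compressionMapHom (n : ℕ) {X Y : Cb.{v} R} (f : X ⟶ Y) (r : ZMod n) :
    compressionX n X r ⟶ compressionX n Y r :=
  compressionDesc fun j hj => f.hom.f j ≫ compressionι n Y r j hj

lemma compressionι_mapHom (n : ℕ) {X Y : Cb.{v} R} (f : X ⟶ Y) (r : ZMod n) (j : ℤ)
    (hj : (j : ZMod n) = r) :
    compressionι n X r j hj ≫ compressionMapHom n f r = f.hom.f j ≫ compressionι n Y r j hj :=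
  compressionι_desc _ _ _

lemma compressionMapHom_id (n : ℕ) (X : Cb.{v} R) (r : ZMod n) :
    compressionMapHom n (𝟙 X) r = 𝟙 _ := by
  refine compression_hom_ext fun j hj => ?_
  rw [compressionι_mapHom, Category.comp_id, ObjectProperty.FullSubcategory.id_hom,
    HomologicalComplex.id_f, Category.id_comp]

lemma compressionMapHom_comp (n : ℕ) {X Y Z : Cb.{v} R} (f : X ⟶ Y) (g : Y ⟶ Z) (r : ZMod n) :
    compressionMapHom n (f ≫ g) r = compressionMapHom n f r ≫ compressionMapHom n g r := by
  refine compression_hom_ext fun j hj => ?_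
  rw [compressionι_mapHom, ← Category.assoc, compressionι_mapHom, Category.assoc,
    compressionι_mapHom, ObjectProperty.FullSubcategory.comp_hom, HomologicalComplex.comp_f,
    Category.assoc]

variable (R) in
/-- The compression functor `Δ : C^b(mod R) ⥤ C_n(mod R)`. -/
noncomputable def compression (n : ℕ) : Cb.{v} R ⥤ PeriodicComplex (FGModuleCat.{v} R) n where
  obj X := compressionObj n X
  map {X Y} f :=
    { f := fun r => compressionMapHom n f r
      comm' := fun r s hrs => by
        refine compression_hom_ext (X := X) fun j hj => ?_
        change _ ≫ _ ≫ compressionD n Y r s = _ ≫ compressionD n X r s ≫ _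
        rw [← Category.assoc, compressionι_mapHom, compressionι_d_assoc X r s hrs,
          compressionι_mapHom, Category.assoc, compressionι_d Y r s hrs,
          HomologicalComplex.Hom.comm_assoc] }
  map_id X := HomologicalComplex.hom_ext _ _ fun r => compressionMapHom_id n X r
  map_comp f g := HomologicalComplex.hom_ext _ _ fun r => compressionMapHom_comp n f g r

/-- The morphism `(Δ(Σⁿ X))^r ⟶ (ΔX)^r` which sends the summand `(Σⁿ X)^j = X^{j+n}`
to the summand `X^{j+n}` by `(-1)^{nj}`. -/
noncomputable def compressionShiftHom (n : ℕ) (X : Cb.{v} R) (r : ZMod n) :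
    compressionX n (X.shift n) r ⟶ compressionX n X r :=
  compressionDesc (X := X.shift n) fun j hj =>
    show X.obj.X (j + n) ⟶ compressionX n X r from
      ((n : ℤ) * j).negOnePow • compressionι n X r (j + n) (by rw [← hj]; push_cast; simp)

lemma compressionι_shiftHom (n : ℕ) (X : Cb.{v} R) (r : ZMod n) (j : ℤ) (hj : (j : ZMod n) = r)
    (hj' : ((j + n : ℤ) : ZMod n) = r) :
    compressionι n (X.shift n) r j hj ≫ compressionShiftHom n X r =
      (show X.obj.X (j + n) ⟶ compressionX n X r from
        ((n : ℤ) * j).negOnePow • compressionι n X r (j + n) hj') :=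
  compressionι_desc _ _ _

/-- The canonical isomorphism `Δ(Σⁿ X) ⟶ ΔX`: it sends the summand `(Σⁿ X)^j = X^{j+n}`
identically to the summand `X^{j+n}`, up to the sign `(-1)^{nj}`, which accounts for the sign
`(-1)ⁿ` in the differential of `Σⁿ X`. -/
noncomputable def compressionShift (n : ℕ) (X : Cb.{v} R) :
    (compression R n).obj (X.shift n) ⟶ (compression R n).obj X where
  f r := compressionShiftHom n X r
  comm' r s hrs := by
    have hrs : r + 1 = s := hrs
    refine compression_hom_ext (X := X.shift n) fun j hj => ?_
    have hr : ∀ i : ℤ, ((i + n : ℤ) : ZMod n) = i := fun i => by push_cast; simp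
    have hj₁ : ((j + 1 : ℤ) : ZMod n) = s := cast_add_one hrs hj
    change _ ≫ _ ≫ compressionD n X r s = _ ≫ compressionD n (X.shift n) r s ≫ _
    rw [← Category.assoc, compressionι_shiftHom n X r j hj ((hr j).trans hj),
      compressionι_d_assoc (X.shift n) r s hrs j hj,
      compressionι_shiftHom n X s (j + 1) hj₁ ((hr _).trans hj₁)]
    change (((n : ℤ) * j).negOnePow • compressionι n X r (j + n) _) ≫ compressionD n X r s =
      ((n : ℤ).negOnePow • X.obj.d (j + n) (j + 1 + n)) ≫
        (((n : ℤ) * (j + 1)).negOnePow • compressionι n X s (j + 1 + n) _)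
    rw [Linear.units_smul_comp, compressionι_d X r s hrs, Linear.units_smul_comp,
      Linear.comp_units_smul, smul_smul, ← Int.negOnePow_add,
      d_compressionι_congr X (show j + n + 1 = j + 1 + n by ring) _ ((hr _).trans hj₁),
      show (n : ℤ) + n * (j + 1) = n * j + (n + n) by ring, Int.negOnePow_add,
      Int.negOnePow_even _ (Even.add_self _), mul_one]

end Compression

/-! ### Derived categories -/

section Derived

variable (R : Type u) [Ring R] [IsNoetherianRing R]

noncomputable instance : HasDerivedCategory.{u + 1} (FGModuleCat.{u} R) :=
  HasDerivedCategory.standard _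

/-- The bounded derived category `D^b(mod R)` of finitely generated `R`-modules. -/
abbrev Db := DerivedCategory.Bounded (FGModuleCat.{u} R)

/-- The canonical functor `C^b(mod R) ⥤ D^b(mod R)`. -/
noncomputable def CbToDb : Cb.{u} R ⥤ Db R :=
  ObjectProperty.lift _ ((boundedComplexes R).ι ⋙ DerivedCategory.Q) (by
    rintro ⟨X, a, b, _, _⟩
    exact ⟨⟨a, inferInstanceAs ((DerivedCategory.Q.obj X).IsGE a)⟩,
      ⟨b, inferInstanceAs ((DerivedCategory.Q.obj X).IsLE b)⟩⟩)

variable {R} in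
/-- The canonical isomorphism `Σ^m X ⟶ Σ^m X` in `D^b(mod R)`, from the image of the shift of a
bounded complex `X` to the shift of the image of `X`. -/
noncomputable def CbToDbShift (X : Cb.{u} R) (m : ℤ) :
    (CbToDb R).obj (X.shift m) ⟶ ((CbToDb R).obj X)⟦m⟧ :=
  ObjectProperty.homMk
    (((DerivedCategory.Q (C := FGModuleCat.{u} R)).commShiftIso m).hom.app X.obj ≫
      ((DerivedCategory.Bounded.ι (C := FGModuleCat.{u} R)).commShiftIso m).inv.app
        ((CbToDb R).obj X))

/-- The `n`-periodic homotopy category `K_n(mod R)`. -/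
abbrev Kn (n : ℕ) := HomotopyCategory (FGModuleCat.{u} R) (ComplexShape.up (ZMod n))

/-- The `n`-periodic derived category `D_n(mod R)`, obtained from `K_n(mod R)` by formally
inverting the quasi-isomorphisms. -/
abbrev Dn (n : ℕ) :=
  (HomotopyCategory.quasiIso (FGModuleCat.{u} R) (ComplexShape.up (ZMod n))).Localization

/-- The canonical functor `C_n(mod R) ⥤ D_n(mod R)`. -/
noncomputable def CnToDn (n : ℕ) : PeriodicComplex (FGModuleCat.{u} R) n ⥤ Dn R n :=
  HomotopyCategory.quotient _ _ ⋙ (HomotopyCategory.quasiIso _ _).Q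

/-- An object of `D_n(mod R)` is gradable if it is isomorphic to the compression of a bounded
complex of finitely generated modules. -/
def gradable (n : ℕ) : ObjectProperty (Dn R n) :=
  fun M => ∃ X : Cb.{u} R, Nonempty ((CnToDn R n).obj ((compression R n).obj X) ≅ M)

/-- The ring `R` has finite (left) global dimension. -/
def HasFiniteGlobalDimension (R : Type u) [Ring R] : Prop :=
  ∃ d : ℕ, ∀ M : ModuleCat.{u} R, HasProjectiveDimensionLE M d

end Derived

lemma isNoetherianRing_mulOpposite (k : Type v) (Λ : Type u) [Field k] [Ring Λ] [Algebra k Λ]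
    [FiniteDimensional k Λ] : IsNoetherianRing Λᵐᵒᵖ :=
  isNoetherian_of_tower k inferInstance

/-!
Write `R` for the opposite ring of `Λ`, so that `mod R` is the category of finitely generated right
`Λ`-modules. The functor `Δ` is constructed from universal arrows. An `n`-periodic complex `M` can be unrolled
to the complex `UM` with `(UM)^j = M^{j mod n}`. On bounded complexes, compression is left adjoint
to unrolling (partially, as `UM` is not bounded), with unit the inclusion `X ⟶ UΔX`. Since `U` is
exact, it induces a functor `U : D_n(mod R) ⥤ D(mod R)`, and every morphism of `D_n(mod R)` starting
at `ΔP`, for `P` a bounded complex of projective modules, comes from a map of complexes: maps of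
complexes `ΔP ⟶ N` are maps `P ⟶ UN`, and these lift through unrolled quasi-isomorphisms
`UM ⟶ UN`, up to homotopy. Hence `P ⟶ UΔP` is a universal arrow from `P` to `U` also on derived
categories (`compressionUnitQ_bijective_of_isKProjective`). As `R` is noetherian of finite global
dimension, every object of `D^b(mod R)` has a bounded resolution by finitely generated projective
modules (`exists_bounded_projective_resolution`), so that these universal arrows define `Δ` on
objects.

The unrolling functor is periodic: there are isomorphisms `Σ^{ni} U ⟶ U`, compatible with the
addition of the integers `i`; this needs the signs `periodSign`. A morphism `(f_i)` in the orbit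
category is sent to the unique morphism `ΔX ⟶ ΔY` which corresponds to the sum of the composites
`X ⟶ Σ^{ni} Y ⟶ Σ^{ni} UΔY ⟶ UΔY` of the `f_i` with the shifted unit and the periodicity
(`UniversalArrows.orbitFunctor`). In this way no additive structure on the localization
`D_n(mod R)` is needed. As a complex, `UΔY` is the direct sum of the complexes `Σ^{ni} Y`, and this
sum is locally finite for bounded `Y`; so `(f_i)` can be recovered from its image, and every morphism
from a bounded complex of projective modules to `UΔY` is obtained
(`orbitHomToUnroll_injective`, `orbitHomToUnroll_surjective`).

The same decomposition shows that compression preserves quasi-isomorphisms of bounded complexes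
(`quasiIso_compression_map`). Therefore `X ⟶ UΔX` is a universal arrow for every bounded complex
`X`, and the comparison of universal arrows gives the isomorphism between `Δ` and the compression of
complexes. Periodicity for `i = 1` has the sign `(-1)^{nj}` in degree `j`, which accounts for
the value of `Δ` on the morphism of degree one.
-/

/-! ### Functors out of orbit categories -/

section UniversalArrows

universe v₁ u₁ v₂ u₂ v₃ u₃

variable {T : Type u₁} [Category.{v₁} T] {T' : Type u₂} [Category.{v₂} T']
  {E : Type u₃} [Category.{v₃} E]

/-- A choice of universal arrows `η X : J X ⟶ U (obj X)` from the objects `J X`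
to the functor `U : E ⥤ T'`; that is, of values of a left adjoint of `U` at the objects `J X`. -/
structure UniversalArrows (J : T ⥤ T') (U : E ⥤ T') where
  /-- the object of `E` attached to an object of `T` -/
  obj : T → E
  /-- the universal arrow -/
  η (X : T) : J.obj X ⟶ U.obj (obj X)
  bijective (X : T) (M : E) : Function.Bijective fun g : obj X ⟶ M => η X ≫ U.map g

namespace UniversalArrows

variable {J : T ⥤ T'} {U : E ⥤ T'} (A : UniversalArrows J U)

lemma hom_ext {X : T} {M : E} {g g' : A.obj X ⟶ M} (h : A.η X ≫ U.map g = A.η X ≫ U.map g') :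
    g = g' :=
  (A.bijective X M).1 h

/-- The morphism `A.obj X ⟶ M` corresponding to `J X ⟶ U M`. -/
noncomputable def desc {X : T} {M : E} (h : J.obj X ⟶ U.obj M) : A.obj X ⟶ M :=
  ((A.bijective X M).2 h).choose

@[simp]
lemma fac {X : T} {M : E} (h : J.obj X ⟶ U.obj M) : A.η X ≫ U.map (A.desc h) = h :=
  ((A.bijective X M).2 h).choose_spec

lemma desc_comp {X : T} {M N : E} (h : J.obj X ⟶ U.obj M) (φ : M ⟶ N) :
    A.desc h ≫ φ = A.desc (h ≫ U.map φ) :=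
  A.hom_ext (by rw [A.fac, U.map_comp, ← Category.assoc, A.fac])

/-- Any two universal arrows from the same object are isomorphic. -/
lemma isIso_desc {X : T} {M : E} (h : J.obj X ⟶ U.obj M)
    (hb : ∀ N : E, Function.Bijective fun g : M ⟶ N => h ≫ U.map g) : IsIso (A.desc h) := by
  obtain ⟨g, hg⟩ := (hb _).2 (A.η X)
  dsimp only at hg
  refine ⟨g, A.hom_ext ?_, (hb _).1 ?_⟩
  · rw [U.map_comp, ← Category.assoc, A.fac, hg, U.map_id, Category.comp_id]
  · dsimp only
    rw [U.map_comp, ← Category.assoc, hg, A.fac, U.map_id, Category.comp_id]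

end UniversalArrows

end UniversalArrows

section OrbitFunctor

universe v' u' v'' u''

variable {T : Type u} [Category.{v} T] [Preadditive T] [HasShift T ℤ]
  {T' : Type u'} [Category.{v'} T'] [Preadditive T'] [HasShift T' ℤ]
  {E : Type u''} [Category.{v''} E]

/-- An `n`-periodicity of a functor `U : E ⥤ T'`: a natural transformation `Σ^{ni} U ⟶ U` for
every `i : ℤ`, where the one for `i = 0` is the identity, and the one for `i + j` is the composite
`Σ^{ni} Σ^{nj} U ⟶ Σ^{ni} U ⟶ U`. -/
structure ShiftPeriodicity (n : ℕ) (U : E ⥤ T') where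
  /-- the transformation `Σ^{ni} U ⟶ U` -/
  τ (i : ℤ) : U ⋙ shiftFunctor T' ((n : ℤ) * i) ⟶ U
  τ_zero (M : E) : (τ 0).app M = (shiftFunctorZero' T' ((n : ℤ) * 0) (mul_zero _)).hom.app (U.obj M)
  τ_add (i j : ℤ) (M : E) :
    (shiftFunctorAdd' T' ((n : ℤ) * j) ((n : ℤ) * i) ((n : ℤ) * (i + j)) (by ring)).inv.app
        (U.obj M) ≫ (τ (i + j)).app M =
      ((τ j).app M)⟦(n : ℤ) * i⟧' ≫ (τ i).app M

namespace ShiftPeriodicity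

variable {n : ℕ} {U : E ⥤ T'} (p : ShiftPeriodicity n U) (J : T ⥤ T') [J.CommShift ℤ] [J.Additive]

/-- The homogeneous part of `extend`: a morphism `f : X ⟶ Σ^{ni} Y` in `T` and a morphism
`h : J Y ⟶ U M` give rise to `J X ⟶ Σ^{ni} J Y ⟶ Σ^{ni} U M ⟶ U M`. -/
noncomputable def extendHom {X Y : T} {M : E} (h : J.obj Y ⟶ U.obj M) (i : ℤ)
    (f : ShiftedHom X Y ((n : ℤ) * i)) : J.obj X ⟶ U.obj M :=
  f.map J ≫ h⟦(n : ℤ) * i⟧' ≫ (p.τ i).app M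

/-- The action of morphisms `X ⟶ Y` in the orbit category on morphisms `J Y ⟶ U M`: the family
`(f_i)` sends `h` to `∑ i, τ_i ∘ Σ^{ni} h ∘ f_i`. -/
noncomputable def extend {X Y : T} {M : E} (h : J.obj Y ⟶ U.obj M) :
    OrbitCategory.OrbitHom n X Y →+ (J.obj X ⟶ U.obj M) :=
  DirectSum.toAddMonoid fun i => AddMonoidHom.mk' (p.extendHom J h i) fun f g => by
    simp only [extendHom, ShiftedHom.map_add, Preadditive.add_comp]

@[simp]
lemma extend_of {X Y : T} {M : E} (h : J.obj Y ⟶ U.obj M) (i : ℤ)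
    (f : ShiftedHom X Y ((n : ℤ) * i)) :
    p.extend J h (DirectSum.of (fun i : ℤ => ShiftedHom X Y ((n : ℤ) * i)) i f) =
      p.extendHom J h i f := by
  exact DirectSum.toAddMonoid_of _ _ _

lemma extend_comp_map {X Y : T} {M N : E} (h : J.obj Y ⟶ U.obj M)
    (f : OrbitCategory.OrbitHom n X Y) (φ : M ⟶ N) :
    p.extend J h f ≫ U.map φ = p.extend J (h ≫ U.map φ) f := by
  induction f using DirectSum.induction_on with
  | zero => simp
  | add f g hf hg => rw [map_add, map_add, Preadditive.add_comp, hf, hg]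
  | of i f =>
    simp only [extend_of, extendHom, Functor.map_comp, Category.assoc]
    congr 2
    exact ((p.τ i).naturality φ).symm

section

variable [∀ m : ℤ, (shiftFunctor T' m).Additive]

lemma extend_add {X Y : T} {M : E} (h h' : J.obj Y ⟶ U.obj M)
    (f : OrbitCategory.OrbitHom n X Y) :
    p.extend J (h + h') f = p.extend J h f + p.extend J h' f := by
  induction f using DirectSum.induction_on with
  | zero => simp
  | add f g hf hg => simp only [map_add, hf, hg]; abel
  | of i f =>
    simp only [extend_of, extendHom, Functor.map_add, Preadditive.add_comp, Preadditive.comp_add]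

lemma extend_zero {X Y : T} (M : E) (f : OrbitCategory.OrbitHom n X Y) :
    p.extend J (0 : J.obj Y ⟶ U.obj M) f = 0 := by
  have := p.extend_add J (0 : J.obj Y ⟶ U.obj M) 0 f
  rwa [add_zero, left_eq_add] at this

end

section

variable [∀ m : ℤ, (shiftFunctor T m).Additive]

lemma extend_proj_map {X Y : T} {M : E} (h : J.obj Y ⟶ U.obj M) (f : X ⟶ Y) :
    p.extend J h ((OrbitCategory.proj T n).map f) = J.map f ≫ h := by
  refine (p.extend_of J h 0 (ShiftedHom.mk₀ _ (mul_zero _) f)).trans ?_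
  rw [extendHom, ShiftedHom.map_mk₀, ShiftedHom.mk₀, p.τ_zero, Category.assoc]
  have := (shiftFunctorZero' T' ((n : ℤ) * 0) (mul_zero _)).inv.naturality_assoc h
    ((shiftFunctorZero' T' ((n : ℤ) * 0) (mul_zero _)).hom.app (U.obj M))
  rw [← this]
  simp

lemma extend_id {X : T} {M : E} (h : J.obj X ⟶ U.obj M) :
    p.extend J h (𝟙 (⟨X⟩ : OrbitCategory T n)) = h := by
  refine (p.extend_proj_map J h (𝟙 X)).trans ?_
  rw [J.map_id, Category.id_comp]

variable [∀ m : ℤ, (shiftFunctor T' m).Additive]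

lemma extend_compHom {X Y Z : T} {M : E} (h : J.obj Z ⟶ U.obj M)
    (f : OrbitCategory.OrbitHom n X Y) (g : OrbitCategory.OrbitHom n Y Z) :
    p.extend J h (OrbitCategory.compHom X Y Z f g) = p.extend J (p.extend J h g) f := by
  induction f using DirectSum.induction_on with
  | zero => simp
  | add f f' hf hf' => simp only [map_add, AddMonoidHom.add_apply, hf, hf']
  | of i f =>
    induction g using DirectSum.induction_on with
    | zero => simp only [map_zero, extend_zero]
    | add g g' hg hg' => simp only [map_add, hg, hg', extend_add]
    | of j g =>
      rw [OrbitCategory.compHom_of_of, extend_of, extend_of, extend_of, extendHom,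
        ShiftedHom.map_comp]
      simp only [extendHom, ShiftedHom.comp, Functor.map_comp, Category.assoc, ← p.τ_add]
      congr 2
      exact ((shiftFunctorAdd' T' ((n : ℤ) * j) ((n : ℤ) * i) ((n : ℤ) * (i + j))
        (by ring)).inv.naturality_assoc h _).symm

end

end ShiftPeriodicity

namespace UniversalArrows

variable {J : T ⥤ T'} {U : E ⥤ T'} (A : UniversalArrows J U)

variable [J.CommShift ℤ] [J.Additive] [∀ m : ℤ, (shiftFunctor T m).Additive]
  [∀ m : ℤ, (shiftFunctor T' m).Additive] {n : ℕ} (p : ShiftPeriodicity n U)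

/-- The functor `T/Σⁿ ⥤ E` defined by universal arrows from the objects of `T` to an `n`-periodic
functor `U : E ⥤ T'`. No additive structure on `E` is needed, as the sum of the contributions
of the components of a morphism in the orbit category is formed in `T'`. -/
noncomputable def orbitFunctor : OrbitCategory T n ⥤ E where
  obj X := A.obj X.obj
  map {X Y} f := A.desc (p.extend J (A.η Y.obj) f)
  map_id X := A.hom_ext (by rw [A.fac, U.map_id, Category.comp_id]; exact p.extend_id J _)
  map_comp {X Y Z} f g := A.hom_ext (by
    rw [A.fac, U.map_comp, ← Category.assoc, A.fac, p.extend_comp_map, A.fac]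
    exact p.extend_compHom J _ f g)

lemma fac_orbitFunctor_map {X Y : OrbitCategory T n} (f : X ⟶ Y) :
    A.η X.obj ≫ U.map ((A.orbitFunctor p).map f) = p.extend J (A.η Y.obj) f :=
  A.fac _

lemma orbitFunctor_map_comp_desc {X Y : OrbitCategory T n} (f : X ⟶ Y) {M : E}
    (h : J.obj Y.obj ⟶ U.obj M) :
    (A.orbitFunctor p).map f ≫ A.desc h = A.desc (p.extend J h f) := by
  refine (A.desc_comp _ _).trans (congrArg _ ((p.extend_comp_map J _ f _).trans ?_))
  rw [A.fac]

lemma orbitFunctor_faithful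
    (h : ∀ X Y : T, Function.Injective (p.extend J (X := X) (A.η Y))) :
    (A.orbitFunctor p).Faithful where
  map_injective {X Y} f g hfg := h X.obj Y.obj (by
    rw [← A.fac_orbitFunctor_map p (X := X) (Y := Y) f, hfg, A.fac_orbitFunctor_map])

lemma orbitFunctor_full
    (h : ∀ X Y : T, Function.Surjective (p.extend J (X := X) (A.η Y))) :
    (A.orbitFunctor p).Full where
  map_surjective {X Y} g := by
    obtain ⟨f, hf⟩ := h X.obj Y.obj (A.η X.obj ≫ U.map g)
    exact ⟨f, A.hom_ext ((A.fac_orbitFunctor_map p f).trans hf)⟩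

end UniversalArrows

end OrbitFunctor

/-! ### Unrolling periodic complexes -/

section Unroll

universe v' u'

namespace PeriodicComplex

section

variable {A : Type u'} [Category.{v'} A] [HasZeroMorphisms A] {n : ℕ}

/-- The unrolled complex `⋯ ⟶ M^j ⟶ M^{j+1} ⟶ ⋯`, `j ∈ ℤ`, of an `n`-periodic complex `M`, where
the upper indices of `M` are read modulo `n`. -/
abbrev unrollObj (M : PeriodicComplex A n) : CochainComplex A ℤ where
  X j := M.X (j : ZMod n)
  d i j := if i + 1 = j then M.d (i : ZMod n) (j : ZMod n) else 0
  shape i j h := if_neg h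
  d_comp_d' i j l hij hjl := by
    split_ifs <;> simp

variable (A n) in
/-- The functor from `n`-periodic complexes to complexes which unrolls an `n`-periodic complex. -/
abbrev unroll : PeriodicComplex A n ⥤ CochainComplex A ℤ where
  obj M := unrollObj M
  map f :=
    { f := fun j => f.f (j : ZMod n)
      comm' := fun i j hij => by
        have hij : i + 1 = j := hij
        simp [hij] }

lemma unrollObj_XIsoOfEq (M : PeriodicComplex A n) {i j : ℤ} (h : i = j) :
    (unrollObj M).XIsoOfEq h = M.XIsoOfEq (congrArg Int.cast h) := rfl

lemma unroll_d (M : PeriodicComplex A n) {i j : ℤ} (h : i + 1 = j) :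
    ((unroll A n).obj M).d i j = M.d (i : ZMod n) (j : ZMod n) := if_pos h

lemma rel_cast {i j : ℤ} (h : i + 1 = j) :
    (ComplexShape.up (ZMod n)).Rel (i : ZMod n) (j : ZMod n) := by
  subst h
  change (i : ZMod n) + 1 = ((i + 1 : ℤ) : ZMod n)
  push_cast
  rfl

/-- In degree `j`, an unrolled complex looks like the periodic complex in degree `j` modulo `n`. -/
def unrollSc'Iso (M : PeriodicComplex A n) (j : ℤ) :
    ((unroll A n).obj M).sc' (j - 1) j (j + 1) ≅
      M.sc' ((j - 1 : ℤ) : ZMod n) (j : ZMod n) ((j + 1 : ℤ) : ZMod n) :=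
  ShortComplex.isoMk (Iso.refl (M.X _)) (Iso.refl (M.X _)) (Iso.refl (M.X _))
    (by
      change 𝟙 _ ≫ M.d _ _ = (if _ then _ else _) ≫ 𝟙 _
      rw [if_pos (by ring), Category.id_comp, Category.comp_id])
    (by
      change 𝟙 _ ≫ M.d _ _ = (if _ then _ else _) ≫ 𝟙 _
      rw [if_pos rfl, Category.id_comp, Category.comp_id])

lemma quasiIsoAt_unroll_map_iff [CategoryWithHomology A] {M N : PeriodicComplex A n} (f : M ⟶ N)
    (j : ℤ) : QuasiIsoAt ((unroll A n).map f) j ↔ QuasiIsoAt f (j : ZMod n) := by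
  have h₁ : ((j - 1 : ℤ) : ZMod n) + 1 = j := by push_cast; ring
  have h₂ : ((j + 1 : ℤ) : ZMod n) = (j : ZMod n) + 1 := by push_cast; ring
  rw [quasiIsoAt_iff' _ (j - 1) j (j + 1) (by simp) (by simp),
    quasiIsoAt_iff' f ((j - 1 : ℤ) : ZMod n) j ((j + 1 : ℤ) : ZMod n)
      ((ComplexShape.up (ZMod n)).prev_eq' h₁) ((ComplexShape.up (ZMod n)).next_eq' h₂.symm)]
  refine ShortComplex.quasiIso_iff_of_arrow_mk_iso _ _
    (Arrow.isoMk (unrollSc'Iso M j) (unrollSc'Iso N j) ?_)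
  ext
  all_goals exact (Category.id_comp _).trans (Category.comp_id _).symm

lemma quasiIso_unroll_map_iff [CategoryWithHomology A] {M N : PeriodicComplex A n} (f : M ⟶ N) :
    QuasiIso ((unroll A n).map f) ↔ QuasiIso f := by
  rw [quasiIso_iff, quasiIso_iff]
  refine ⟨fun h r => ?_, fun h j => (quasiIsoAt_unroll_map_iff f j).2 (h _)⟩
  obtain ⟨j, rfl⟩ := ZMod.intCast_surjective r
  exact (quasiIsoAt_unroll_map_iff f j).1 (h j)

end

section

variable {A : Type u'} [Category.{v'} A] [Preadditive A] {n : ℕ}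

/-- The homotopy between the unrolled maps given by a homotopy of maps of periodic complexes. -/
def unrollHomotopy {M N : PeriodicComplex A n} {f g : M ⟶ N} (h : Homotopy f g) :
    Homotopy ((unroll A n).map f) ((unroll A n).map g) where
  hom i j := if j + 1 = i then h.hom (i : ZMod n) (j : ZMod n) else 0
  zero i j hij := if_neg hij
  comm j := by
    have hj₁ : (ComplexShape.up ℤ).Rel (j - 1) j := by simp
    have hj₂ : (ComplexShape.up ℤ).Rel j (j + 1) := by simp
    have := h.comm (j : ZMod n)
    rw [dNext_eq _ (rel_cast (n := n) hj₂), prevD_eq _ (rel_cast (n := n) hj₁)] at this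
    rw [dNext_eq _ hj₂, prevD_eq _ hj₁]
    simpa using this

/-- The sign `(-1)^{n (ij + i(i-1)/2)}` in degree `j` of the isomorphism from `Σ^{ni} U M` to `U M`,
for `U M` the unrolled complex of an `n`-periodic complex `M`. The term `ij` accounts for
the sign `(-1)^{ni}` in the differential of `Σ^{ni} U M`; the term `i(i-1)/2` is the correction
needed for the isomorphisms to be compatible with the composition of shifts. -/
def periodSign (n : ℕ) (i j : ℤ) : ℤˣ := ((n : ℤ) * (i * j + i * (i - 1) / 2)).negOnePow

lemma periodSign_zero (n : ℕ) (j : ℤ) : periodSign n 0 j = 1 := by simp [periodSign]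

lemma periodSign_one (n : ℕ) (j : ℤ) : periodSign n 1 j = ((n : ℤ) * j).negOnePow := by
  simp [periodSign]

lemma periodSign_succ (n : ℕ) (i j : ℤ) :
    periodSign n i (j + 1) = ((n : ℤ) * i).negOnePow * periodSign n i j := by
  rw [periodSign, periodSign, ← Int.negOnePow_add]
  congr 1
  ring

lemma periodSign_add (n : ℕ) (i k j : ℤ) :
    periodSign n (i + k) j = periodSign n k (j + n * i) * periodSign n i j := by
  rw [periodSign, periodSign, periodSign, ← Int.negOnePow_add, Int.negOnePow_eq_iff]
  obtain ⟨a, ha⟩ := Int.even_mul_pred_self i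
  obtain ⟨b, hb⟩ := Int.even_mul_pred_self k
  have hab : (i + k) * (i + k - 1) = 2 * (a + b + i * k) := by linear_combination ha + hb
  rw [show i * (i - 1) / 2 = a by omega, show k * (k - 1) / 2 = b by omega,
    show (i + k) * (i + k - 1) / 2 = a + b + i * k by omega]
  have : Even ((n : ℤ) * (n - 1)) := Int.even_mul_pred_self n
  obtain ⟨c, hc⟩ := this
  exact ⟨-(c * (i * k)), by linear_combination (-(i * k)) * hc⟩

lemma cast_add_mul_eq (n : ℕ) (i j : ℤ) : ((j + n * i : ℤ) : ZMod n) = (j : ZMod n) := by simp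

/-- The canonical map `Σ^{ni} U M ⟶ U M`, for `U M` the unrolled complex of an `n`-periodic
complex `M`. Up to the sign `periodSign`, it is the identity of `M^{j+ni} = M^j` in degree `j`. -/
noncomputable def unrollPeriod (n : ℕ) (i : ℤ) :
    unroll A n ⋙ shiftFunctor (CochainComplex A ℤ) ((n : ℤ) * i) ⟶ unroll A n where
  app M :=
    { f := fun j => show M.X ((j + n * i : ℤ) : ZMod n) ⟶ M.X (j : ZMod n) from
        periodSign n i j • (M.XIsoOfEq (cast_add_mul_eq n i j)).hom
      comm' := fun j l hjl => by
        have hjl : j + 1 = l := hjl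
        subst hjl
        dsimp
        rw [if_pos rfl, if_pos (by ring), periodSign_succ]
        simp only [Linear.units_smul_comp, Linear.comp_units_smul, smul_smul,
          HomologicalComplex.XIsoOfEq_hom_comp_d, HomologicalComplex.d_comp_XIsoOfEq_hom]
        rw [mul_right_comm, ← Int.negOnePow_add, Int.negOnePow_even _ (Even.add_self _),
          one_mul] }
  naturality M N f := by
    ext j
    dsimp
    rw [Linear.units_smul_comp, Linear.comp_units_smul]
    congr 1
    exact HomologicalComplex.XIsoOfEq_hom_naturality f (cast_add_mul_eq n i j)

lemma unrollPeriod_app_f (n : ℕ) (i : ℤ) (M : PeriodicComplex A n) (j : ℤ) :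
    ((unrollPeriod n i).app M).f j =
      (show M.X ((j + n * i : ℤ) : ZMod n) ⟶ M.X (j : ZMod n) from
        periodSign n i j • (M.XIsoOfEq (cast_add_mul_eq n i j)).hom) := rfl

lemma unrollPeriod_zero (n : ℕ) (M : PeriodicComplex A n) :
    (unrollPeriod n 0).app M =
      (shiftFunctorZero' (CochainComplex A ℤ) ((n : ℤ) * 0) (mul_zero _)).hom.app
        ((unroll A n).obj M) := by
  ext j
  rw [unrollPeriod_app_f, periodSign_zero, one_smul]
  simp [shiftFunctorZero', CochainComplex.shiftFunctorZero_hom_app_f]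
  rfl

lemma unrollPeriod_add (n : ℕ) (i j : ℤ) (M : PeriodicComplex A n) :
    (shiftFunctorAdd' (CochainComplex A ℤ) ((n : ℤ) * j) ((n : ℤ) * i) ((n : ℤ) * (i + j))
        (by ring)).inv.app ((unroll A n).obj M) ≫ (unrollPeriod n (i + j)).app M =
      ((unrollPeriod n j).app M)⟦(n : ℤ) * i⟧' ≫ (unrollPeriod n i).app M := by
  ext l
  rw [HomologicalComplex.comp_f, HomologicalComplex.comp_f, CochainComplex.shiftFunctor_map_f',
    CochainComplex.shiftFunctorAdd'_inv_app_f', unrollPeriod_app_f, unrollPeriod_app_f,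
    unrollPeriod_app_f, periodSign_add]
  simp only [Functor.comp_obj, CochainComplex.shiftFunctor_obj_X', Linear.units_smul_comp,
    Linear.comp_units_smul]
  rw [unrollObj_XIsoOfEq, HomologicalComplex.XIsoOfEq_hom_comp_XIsoOfEq_hom,
    HomologicalComplex.XIsoOfEq_hom_comp_XIsoOfEq_hom, smul_smul, mul_comm (periodSign n i l)]

end

end PeriodicComplex

end Unroll

/-! ### The unrolling functor on derived categories -/

section DerivedUnroll

lemma commShiftIso_inv_app_comp_map_shiftFunctorZero' {C D : Type*} [Category* C] [Category* D]
    [HasShift C ℤ] [HasShift D ℤ] (F : C ⥤ D) [F.CommShift ℤ] (a : ℤ) (h : a = 0) (X : C) :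
    (F.commShiftIso a).inv.app X ≫ F.map ((shiftFunctorZero' C a h).hom.app X) =
      (shiftFunctorZero' D a h).hom.app (F.obj X) := by
  subst h
  simp [F.commShiftIso_zero, shiftFunctorZero', ← F.map_comp]

lemma shiftFunctorAdd'_inv_comp_commShiftIso_inv {C D : Type*} [Category* C] [Category* D]
    [HasShift C ℤ] [HasShift D ℤ] (F : C ⥤ D) [F.CommShift ℤ] (a b c : ℤ) (h : a + b = c) (X : C) :
    (shiftFunctorAdd' D a b c h).inv.app (F.obj X) ≫ (F.commShiftIso c).inv.app X =
      ((F.commShiftIso a).inv.app X)⟦b⟧' ≫ (F.commShiftIso b).inv.app (X⟦a⟧) ≫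
        F.map ((shiftFunctorAdd' C a b c h).inv.app X) := by
  simp [F.commShiftIso_add' h, Functor.CommShift.isoAdd'_inv_app]

/-- The periodicity of the composite of a periodic functor with a functor which commutes with
shifts. -/
noncomputable def ShiftPeriodicity.comp {E C D : Type*} [Category* E] [Category* C] [Category* D]
    [HasShift C ℤ] [HasShift D ℤ] {n : ℕ} {U : E ⥤ C} (p : ShiftPeriodicity n U) (F : C ⥤ D)
    [F.CommShift ℤ] : ShiftPeriodicity n (U ⋙ F) where
  τ i :=
    { app M := (F.commShiftIso ((n : ℤ) * i)).inv.app (U.obj M) ≫ F.map ((p.τ i).app M)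
      naturality M N f := by
        have h := F.congr_map ((p.τ i).naturality f)
        dsimp at h ⊢
        rw [Functor.map_comp, Functor.map_comp] at h
        rw [Category.assoc, ← h, ← Functor.commShiftIso_inv_naturality_assoc] }
  τ_zero M := by
    dsimp
    rw [p.τ_zero, commShiftIso_inv_app_comp_map_shiftFunctorZero']
  τ_add i j M := by
    have h := F.congr_map (p.τ_add i j M)
    dsimp
    rw [Functor.map_comp, Functor.map_comp] at h
    rw [← Category.assoc, shiftFunctorAdd'_inv_comp_commShiftIso_inv, Functor.map_comp,
      Category.assoc, Category.assoc, Category.assoc, h,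
      ← Functor.commShiftIso_inv_naturality_assoc]

/-- The unrolling functor is periodic. -/
noncomputable def unrollPeriodicity (A : Type*) [Category* A] [Preadditive A] (n : ℕ) :
    ShiftPeriodicity n (PeriodicComplex.unroll A n) where
  τ := PeriodicComplex.unrollPeriod n
  τ_zero := PeriodicComplex.unrollPeriod_zero n
  τ_add := PeriodicComplex.unrollPeriod_add n

variable (R : Type u) [Ring R] [IsNoetherianRing R] (n : ℕ)

open PeriodicComplex

/-- The functor `K_n(mod R) ⥤ D(mod R)` induced by unrolling complexes. -/
noncomputable def unrollKn : Kn R n ⥤ DerivedCategory (FGModuleCat.{u} R) :=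
  CategoryTheory.Quotient.lift _ (unroll (FGModuleCat.{u} R) n ⋙ DerivedCategory.Q)
    fun _ _ _ _ ⟨h⟩ => DerivedCategory.Q_map_eq_of_homotopy _ (unrollHomotopy h)

lemma unrollKn_inverts :
    (HomotopyCategory.quasiIso (FGModuleCat.{u} R) (ComplexShape.up (ZMod n))).IsInvertedBy
      (unrollKn R n) := by
  rintro ⟨M⟩ ⟨N⟩ f hf
  obtain ⟨f, rfl⟩ := (HomotopyCategory.quotient _ _).map_surjective f
  have hf : QuasiIso f := (HomotopyCategory.quotient_map_mem_quasiIso_iff f).1 hf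
  have := (quasiIso_unroll_map_iff f).2 hf
  exact inferInstanceAs (IsIso (DerivedCategory.Q.map ((unroll _ n).map f)))

/-- The functor `D_n(mod R) ⥤ D(mod R)` induced by unrolling complexes. -/
noncomputable def unrollDn : Dn R n ⥤ DerivedCategory (FGModuleCat.{u} R) :=
  Localization.Construction.lift (unrollKn R n) (unrollKn_inverts R n)

variable {R n}

lemma unrollDn_map_CnToDn {M N : PeriodicComplex (FGModuleCat.{u} R) n} (f : M ⟶ N) :
    (unrollDn R n).map ((CnToDn R n).map f) = DerivedCategory.Q.map ((unroll _ n).map f) := by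
  have := Functor.congr_hom
    (Localization.Construction.fac (unrollKn R n) (unrollKn_inverts R n))
    ((HomotopyCategory.quotient _ _).map f)
  exact this.trans ((Category.id_comp _).trans (Category.comp_id _))

lemma CnToDn_obj_surjective (M : Dn R n) : ∃ N, (CnToDn R n).obj N = M := by
  obtain ⟨⟨⟨N⟩⟩⟩ := M
  exact ⟨N, rfl⟩

lemma CnToDn_map_eq_of_homotopy {M N : PeriodicComplex (FGModuleCat.{u} R) n} {f g : M ⟶ N}
    (h : Homotopy f g) : (CnToDn R n).map f = (CnToDn R n).map g :=
  congrArg (HomotopyCategory.quasiIso _ _).Q.map (HomotopyCategory.eq_of_homotopy _ _ h)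

lemma isIso_CnToDn_map {M N : PeriodicComplex (FGModuleCat.{u} R) n} (f : M ⟶ N) [QuasiIso f] :
    IsIso ((CnToDn R n).map f) :=
  Localization.inverts (HomotopyCategory.quasiIso _ _).Q
    (HomotopyCategory.quasiIso (FGModuleCat.{u} R) (ComplexShape.up (ZMod n))) _
    ((HomotopyCategory.quotient_map_mem_quasiIso_iff f).2 ‹_›)

/-- A property of morphisms of `D_n(mod R)` which is stable under composition holds for all
morphisms if it holds for maps of periodic complexes and for the inverses of quasi-isomorphisms. -/
lemma Dn_morphismProperty_eq_top (P : MorphismProperty (Dn R n)) [P.IsStableUnderComposition]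
    (h₁ : ∀ ⦃M N : PeriodicComplex (FGModuleCat.{u} R) n⦄ (f : M ⟶ N), P ((CnToDn R n).map f))
    (h₂ : ∀ ⦃M N : PeriodicComplex (FGModuleCat.{u} R) n⦄ (f : M ⟶ N) (_ : QuasiIso f)
      (g : (CnToDn R n).obj N ⟶ (CnToDn R n).obj M) (_ : g ≫ (CnToDn R n).map f = 𝟙 _), P g) :
    P = ⊤ := by
  refine Localization.Construction.morphismProperty_eq_top P ?_ ?_
  · rintro ⟨M⟩ ⟨N⟩ f
    obtain ⟨f, rfl⟩ := (HomotopyCategory.quotient _ _).map_surjective f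
    exact h₁ f
  · rintro ⟨M⟩ ⟨N⟩ f hf
    obtain ⟨f, rfl⟩ := (HomotopyCategory.quotient _ _).map_surjective f
    exact h₂ f ((HomotopyCategory.quotient_map_mem_quasiIso_iff f).1 hf) _
      (Localization.Construction.wIso _ hf).inv_hom_id

variable (R n) in
/-- Natural transformations between functors on `D_n(mod R)` can be constructed
on complexes. -/
noncomputable def DnNatTrans {C : Type*} [Category* C] {F G : Dn R n ⥤ C}
    (τ : CnToDn R n ⋙ F ⟶ CnToDn R n ⋙ G) : F ⟶ G :=
  Localization.Construction.natTransExtension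
    (Quotient.natTransLift (r := homotopic (FGModuleCat.{u} R) (ComplexShape.up (ZMod n)))
      (F := (HomotopyCategory.quasiIso (FGModuleCat.{u} R) (ComplexShape.up (ZMod n))).Q ⋙ F)
      (G := (HomotopyCategory.quasiIso (FGModuleCat.{u} R) (ComplexShape.up (ZMod n))).Q ⋙ G) τ)

lemma DnNatTrans_app {C : Type*} [Category* C] {F G : Dn R n ⥤ C}
    (τ : CnToDn R n ⋙ F ⟶ CnToDn R n ⋙ G) (M : PeriodicComplex (FGModuleCat.{u} R) n) :
    (DnNatTrans R n τ).app ((CnToDn R n).obj M) = τ.app M :=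
  Localization.Construction.NatTransExtension.app_eq _ _

variable (R n) in
/-- The `n`-periodicity `Σ^{ni} U ⟶ U` of the unrolling functor `U : C_n(mod R) ⥤ D(mod R)`. -/
noncomputable def unrollPeriodicityQ :
    ShiftPeriodicity n (unroll (FGModuleCat.{u} R) n ⋙ DerivedCategory.Q) :=
  (unrollPeriodicity (FGModuleCat.{u} R) n).comp DerivedCategory.Q

variable (R n) in
/-- The transformation `Σ^{ni} U ⟶ U` for the unrolling functor `U : D_n(mod R) ⥤ D(mod R)`. -/
noncomputable def unrollDnτ (i : ℤ) :
    unrollDn R n ⋙ shiftFunctor (DerivedCategory (FGModuleCat.{u} R)) ((n : ℤ) * i) ⟶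
      unrollDn R n :=
  DnNatTrans R n
    { app M := ((unrollPeriodicityQ R n).τ i).app M
      naturality M N f := by
        change ((unrollDn R n).map ((CnToDn R n).map f))⟦(n : ℤ) * i⟧' ≫ _ =
          _ ≫ (unrollDn R n).map ((CnToDn R n).map f)
        rw [unrollDn_map_CnToDn]
        exact ((unrollPeriodicityQ R n).τ i).naturality f }

lemma unrollDnτ_app (i : ℤ) (M : PeriodicComplex (FGModuleCat.{u} R) n) :
    (unrollDnτ R n i).app ((CnToDn R n).obj M) = ((unrollPeriodicityQ R n).τ i).app M :=
  DnNatTrans_app _ M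

variable (R n) in
/-- The `n`-periodicity of the unrolling functor `D_n(mod R) ⥤ D(mod R)`. -/
noncomputable def unrollDnPeriodicity : ShiftPeriodicity n (unrollDn R n) where
  τ := unrollDnτ R n
  τ_zero M := by
    obtain ⟨M, rfl⟩ := CnToDn_obj_surjective M
    rw [unrollDnτ_app]
    exact (unrollPeriodicityQ R n).τ_zero M
  τ_add i j M := by
    obtain ⟨M, rfl⟩ := CnToDn_obj_surjective M
    rw [unrollDnτ_app, unrollDnτ_app, unrollDnτ_app]
    exact (unrollPeriodicityQ R n).τ_add i j M

end DerivedUnroll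

/-! ### Compression and unrolling are adjoint -/

section Adjunction

open PeriodicComplex

section

variable {R : Type u} [Ring R] (n : ℕ)

namespace Compression

/-- The inclusion of the direct summand `X^j` in the degree `r` part `⨁_{j ≡ r (n)} X^j` of the
compression of `X`; it is `compressionι`, typed in terms of the functor `compression`. -/
noncomputable def ι (X : Cb.{v} R) (r : ZMod n) (j : ℤ) (hj : (j : ZMod n) = r) :
    X.obj.X j ⟶ ((compression R n).obj X).X r :=
  compressionι n X r j hj

variable {n} {X Y : Cb.{v} R}

/-- The morphism on `⨁_{j ≡ r (n)} X^j` with the given restrictions to the summands. -/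
noncomputable def desc {r : ZMod n} {M : FGModuleCat.{v} R}
    (f : ∀ j : ℤ, (j : ZMod n) = r → (X.obj.X j ⟶ M)) : ((compression R n).obj X).X r ⟶ M :=
  compressionDesc f

lemma ι_desc {r : ZMod n} {M : FGModuleCat.{v} R}
    (f : ∀ j : ℤ, (j : ZMod n) = r → (X.obj.X j ⟶ M)) (j : ℤ) (hj : (j : ZMod n) = r) :
    ι n X r j hj ≫ desc f = f j hj :=
  compressionι_desc f j hj

lemma hom_ext {r : ZMod n} {M : FGModuleCat.{v} R} {f g : ((compression R n).obj X).X r ⟶ M}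
    (h : ∀ (j : ℤ) (hj : (j : ZMod n) = r), ι n X r j hj ≫ f = ι n X r j hj ≫ g) : f = g :=
  compression_hom_ext h

lemma ι_d {r s : ZMod n} {j l : ℤ} (h : j + 1 = l) (hj : (j : ZMod n) = r)
    (hl : (l : ZMod n) = s) :
    ι n X r j hj ≫ ((compression R n).obj X).d r s = X.obj.d j l ≫ ι n X s l hl := by
  subst h hj hl
  exact compressionι_d X _ _ (rel_cast rfl) j rfl

lemma ι_map_f (f : X ⟶ Y) (r : ZMod n) (j : ℤ) (hj : (j : ZMod n) = r) :
    ι n X r j hj ≫ ((compression R n).map f).f r = f.hom.f j ≫ ι n Y r j hj :=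
  compressionι_mapHom n f r j hj

end Compression

/-- The unit `X ⟶ UΔX` of the adjunction between compression and unrolling: in degree `j`,
it is the inclusion of the summand `X^j`. -/
noncomputable def compressionUnit (X : Cb.{v} R) :
    X.obj ⟶ (unroll _ n).obj ((compression R n).obj X) where
  f j := Compression.ι n X (j : ZMod n) j rfl
  comm' i j hij := by
    rw [unroll_d _ hij]
    exact Compression.ι_d hij rfl rfl

lemma compressionUnit_naturality {X Y : Cb.{v} R} (f : X ⟶ Y) :
    compressionUnit n X ≫ (unroll _ n).map ((compression R n).map f) =
      f.hom ≫ compressionUnit n Y := by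
  ext j : 1
  exact Compression.ι_map_f f _ j rfl

variable {n} {X : Cb.{v} R} {M : PeriodicComplex (FGModuleCat.{v} R) n}

/-- The map of periodic complexes `ΔX ⟶ M` corresponding to a map `X ⟶ UM`. -/
noncomputable def compressionAdj (φ : X.obj ⟶ (unroll _ n).obj M) :
    (compression R n).obj X ⟶ M where
  f r := Compression.desc fun j hj => φ.f j ≫ (M.XIsoOfEq hj).hom
  comm' r s hrs := by
    refine Compression.hom_ext fun j hj => ?_
    have hrs : r + 1 = s := hrs
    have hs : ((j + 1 : ℤ) : ZMod n) = s := cast_add_one hrs hj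
    subst hj hs
    have hφ := φ.comm j (j + 1)
    rw [unroll_d _ rfl] at hφ
    rw [← Category.assoc, Compression.ι_desc, ← Category.assoc (Compression.ι _ _ _ _ _),
      Compression.ι_d rfl rfl rfl, Category.assoc, Category.assoc, Compression.ι_desc]
    simpa using hφ

lemma compressionUnit_compressionAdj (φ : X.obj ⟶ (unroll _ n).obj M) :
    compressionUnit n X ≫ (unroll _ n).map (compressionAdj φ) = φ := by
  ext j : 1
  change Compression.ι n X (j : ZMod n) j rfl ≫
    Compression.desc (fun i hi => φ.f i ≫ (M.XIsoOfEq hi).hom) = φ.f j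
  rw [Compression.ι_desc]
  simp

section

variable {g g' : (compression R n).obj X ⟶ M}
  (H : Homotopy (compressionUnit n X ≫ (unroll _ n).map g)
    (compressionUnit n X ≫ (unroll _ n).map g'))

open scoped Classical in
/-- The components of `compressionAdjHomotopy`. -/
noncomputable def compressionAdjHomotopyHom (r s : ZMod n) :
    ((compression R n).obj X).X r ⟶ M.X s :=
  if h : s + 1 = r then
    Compression.desc fun j hj => H.hom j (j - 1) ≫
      (M.XIsoOfEq (show ((j - 1 : ℤ) : ZMod n) = s by
        rw [Int.cast_sub, Int.cast_one, hj, ← h, add_sub_cancel_right])).hom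
  else 0

lemma compressionι_adjHomotopyHom (j l : ℤ) (h : l + 1 = j) :
    Compression.ι n X (j : ZMod n) j rfl ≫
      compressionAdjHomotopyHom H (j : ZMod n) (l : ZMod n) = H.hom j l := by
  obtain rfl : l = j - 1 := by omega
  have h' : ((j - 1 : ℤ) : ZMod n) + 1 = (j : ZMod n) := rel_cast h
  rw [compressionAdjHomotopyHom, dif_pos h', Compression.ι_desc]
  simp

/-- Two maps `ΔX ⟶ M` are homotopic if the corresponding maps `X ⟶ UM` are. -/
noncomputable def compressionAdjHomotopy : Homotopy g g' where
  hom r s := compressionAdjHomotopyHom H r s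
  zero r s hrs := dif_neg hrs
  comm r := by
    refine Compression.hom_ext fun j hj => ?_
    subst hj
    have h₁ : (ComplexShape.up ℤ).Rel (j - 1) j := by simp
    have h₂ : (ComplexShape.up ℤ).Rel j (j + 1) := by simp
    have h := H.comm j
    rw [dNext_eq _ h₂, prevD_eq _ h₁, unroll_d _ h₁] at h
    rw [dNext_eq _ (rel_cast (n := n) h₂), prevD_eq _ (rel_cast (n := n) h₁),
      Preadditive.comp_add, Preadditive.comp_add, ← Category.assoc, ← Category.assoc,
      Compression.ι_d h₂ rfl rfl, Category.assoc, compressionι_adjHomotopyHom H (j + 1) j h₂,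
      compressionι_adjHomotopyHom H j (j - 1) h₁]
    exact h

end

end

/-! ### Universal arrows for bounded complexes of projective modules -/

section

variable {A : Type*} [Category* A] [Abelian A] [HasDerivedCategory A]

lemma CochainComplex.IsKProjective.Q_map_surjective (K L : CochainComplex A ℤ) [K.IsKProjective]
    (φ : DerivedCategory.Q.obj K ⟶ DerivedCategory.Q.obj L) :
    ∃ f : K ⟶ L, DerivedCategory.Q.map f = φ := by
  obtain ⟨f, hf⟩ := (Qh_map_bijective K ((HomotopyCategory.quotient _ _).obj L)).surjective
    ((DerivedCategory.quotientCompQhIso A).hom.app K ≫ φ ≫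
      (DerivedCategory.quotientCompQhIso A).inv.app L)
  obtain ⟨f, rfl⟩ := (HomotopyCategory.quotient _ _).map_surjective f
  refine ⟨f, ?_⟩
  have := DerivedCategory.quotientCompQhIso_hom_naturality f
  rw [hf] at this
  simpa using this.symm

lemma CochainComplex.IsKProjective.homotopy_of_Q_map_eq {K L : CochainComplex A ℤ}
    [K.IsKProjective] {f g : K ⟶ L} (h : DerivedCategory.Q.map f = DerivedCategory.Q.map g) :
    Nonempty (Homotopy f g) := by
  refine ⟨HomotopyCategory.homotopyOfEq _ _
    ((Qh_map_bijective K ((HomotopyCategory.quotient _ _).obj L)).injective ?_)⟩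
  have h₁ := DerivedCategory.quotientCompQhIso_hom_naturality f
  have h₂ := DerivedCategory.quotientCompQhIso_hom_naturality g
  rw [h, ← h₂] at h₁
  exact (cancel_mono _).1 h₁

end

variable {R : Type u} [Ring R] [IsNoetherianRing R] {n : ℕ}

/-- Maps `ΔP ⟶ M` of periodic complexes are equal in `D_n(mod R)` if the corresponding maps
`P ⟶ UM` are equal in `D(mod R)`, for `P` K-projective. -/
lemma CnToDn_map_eq_of_Q_map_eq {P : Cb.{u} R} [P.obj.IsKProjective]
    {M : PeriodicComplex (FGModuleCat.{u} R) n} {f g : (compression R n).obj P ⟶ M}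
    (h : DerivedCategory.Q.map (compressionUnit n P ≫ (unroll _ n).map f) =
      DerivedCategory.Q.map (compressionUnit n P ≫ (unroll _ n).map g)) :
    (CnToDn R n).map f = (CnToDn R n).map g := by
  obtain ⟨H⟩ := CochainComplex.IsKProjective.homotopy_of_Q_map_eq h
  exact CnToDn_map_eq_of_homotopy (compressionAdjHomotopy H)

/-- Maps from `ΔP` lift along quasi-isomorphisms, up to equality in `D_n(mod R)`, for `P`
K-projective. -/
lemma exists_CnToDn_map_eq_comp_inverse {P : Cb.{u} R} [P.obj.IsKProjective]
    {M N : PeriodicComplex (FGModuleCat.{u} R) n} (f : M ⟶ N) (hf : QuasiIso f)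
    (g : (CnToDn R n).obj N ⟶ (CnToDn R n).obj M) (hg : g ≫ (CnToDn R n).map f = 𝟙 _)
    (a : (compression R n).obj P ⟶ N) :
    ∃ b : (compression R n).obj P ⟶ M, (CnToDn R n).map a ≫ g = (CnToDn R n).map b := by
  have := isIso_CnToDn_map f
  have : QuasiIso ((unroll _ n).map f) := (quasiIso_unroll_map_iff f).2 hf
  have : IsIso (DerivedCategory.Q.map ((unroll _ n).map f)) :=
    (DerivedCategory.isIso_Q_map_iff_quasiIso _ _).2 this
  obtain ⟨b, hb⟩ := CochainComplex.IsKProjective.Q_map_surjective _ _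
    (DerivedCategory.Q.map (compressionUnit n P ≫ (unroll _ n).map a) ≫
      inv (DerivedCategory.Q.map ((unroll _ n).map f)))
  refine ⟨compressionAdj b, ?_⟩
  rw [← cancel_mono ((CnToDn R n).map f), Category.assoc, hg, Category.comp_id,
    ← Functor.map_comp]
  refine CnToDn_map_eq_of_Q_map_eq ?_
  rw [Functor.map_comp (unroll _ n) (compressionAdj b), ← Category.assoc,
    compressionUnit_compressionAdj, Functor.map_comp _ b, hb, Category.assoc, IsIso.inv_hom_id,
    Category.comp_id]

/-- Every morphism `ΔP ⟶ M` in `D_n(mod R)` comes from a map of periodic complexes if `P` is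
K-projective. -/
lemma CnToDn_map_surjective (P : Cb.{u} R) [P.obj.IsKProjective]
    {M : PeriodicComplex (FGModuleCat.{u} R) n}
    (g : (CnToDn R n).obj ((compression R n).obj P) ⟶ (CnToDn R n).obj M) :
    ∃ f, (CnToDn R n).map f = g := by
  -- the morphisms in `D_n(mod R)` composition with which preserves the maps of complexes from `ΔP`
  let W : MorphismProperty (Dn R n) := fun M N φ =>
    ∀ a : (compression R n).obj P ⟶ M.as.obj.as, ∃ b : (compression R n).obj P ⟶ N.as.obj.as,
      (CnToDn R n).map a ≫ φ = (CnToDn R n).map b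
  have : W.IsStableUnderComposition := ⟨fun φ ψ hφ hψ a => by
    obtain ⟨b, hb⟩ := hφ a
    obtain ⟨c, hc⟩ := hψ b
    exact ⟨c, by rw [← hc, ← hb]; exact (Category.assoc _ _ _).symm⟩⟩
  have hW : W = ⊤ := Dn_morphismProperty_eq_top W
    (fun M N f a => ⟨a ≫ f, (Functor.map_comp _ _ _).symm⟩)
    fun M N f hf g hg a => exists_CnToDn_map_eq_comp_inverse f hf g hg a
  have hg : W g := hW ▸ MorphismProperty.top_apply g
  obtain ⟨b, hb⟩ := hg (𝟙 ((compression R n).obj P))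
  have h : (CnToDn R n).map (𝟙 ((compression R n).obj P)) ≫ g = g := by
    rw [CategoryTheory.Functor.map_id, Category.id_comp]
  exact ⟨b, hb.symm.trans h⟩

/-- The unit `X ⟶ UΔX` in `D(mod R)`. -/
noncomputable def compressionUnitQ (n : ℕ) (X : Cb.{u} R) :
    DerivedCategory.Q.obj X.obj ⟶
      (unrollDn R n).obj ((CnToDn R n).obj ((compression R n).obj X)) :=
  DerivedCategory.Q.map (compressionUnit n X)

lemma compressionUnitQ_map {X : Cb.{u} R} {M : PeriodicComplex (FGModuleCat.{u} R) n}
    (f : (compression R n).obj X ⟶ M) :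
    compressionUnitQ n X ≫ (unrollDn R n).map ((CnToDn R n).map f) =
      DerivedCategory.Q.map (compressionUnit n X ≫ (unroll _ n).map f) := by
  rw [unrollDn_map_CnToDn, Functor.map_comp]
  rfl

lemma compressionUnitQ_naturality {X Y : Cb.{u} R} (f : X ⟶ Y) :
    compressionUnitQ n X ≫ (unrollDn R n).map ((CnToDn R n).map ((compression R n).map f)) =
      DerivedCategory.Q.map f.hom ≫ compressionUnitQ n Y := by
  rw [compressionUnitQ_map, compressionUnit_naturality, Functor.map_comp]
  rfl

/-- For K-projective `P`, the unit `P ⟶ UΔP` is a universal arrow from `P` to the unrolling functor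
`U : D_n(mod R) ⥤ D(mod R)`. -/
lemma compressionUnitQ_bijective_of_isKProjective (P : Cb.{u} R) [P.obj.IsKProjective]
    (M : Dn R n) :
    Function.Bijective fun g : (CnToDn R n).obj ((compression R n).obj P) ⟶ M =>
      compressionUnitQ n P ≫ (unrollDn R n).map g := by
  obtain ⟨M, rfl⟩ := CnToDn_obj_surjective M
  constructor
  · intro g g' h
    obtain ⟨g, rfl⟩ := CnToDn_map_surjective P g
    obtain ⟨g', rfl⟩ := CnToDn_map_surjective P g'
    dsimp only at h
    rw [compressionUnitQ_map, compressionUnitQ_map] at h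
    exact CnToDn_map_eq_of_Q_map_eq h
  · intro φ
    obtain ⟨f, rfl⟩ := CochainComplex.IsKProjective.Q_map_surjective P.obj ((unroll _ n).obj M) φ
    exact ⟨(CnToDn R n).map (compressionAdj f),
      (compressionUnitQ_map _).trans (by rw [compressionUnit_compressionAdj])⟩

end Adjunction

/-! ### The decomposition of the unrolled compression -/

section Decomposition

open PeriodicComplex

variable {R : Type u} [Ring R] {n : ℕ}

namespace Compression

variable {X Y : Cb.{v} R}

/-- The projection from `⨁_{j ≡ r (n)} X^j` to `X^l`. -/
noncomputable def π (X : Cb.{v} R) (r : ZMod n) (l : ℤ) :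
    ((compression R n).obj X).X r ⟶ X.obj.X l :=
  desc fun j _ => if h : j = l then (X.obj.XIsoOfEq h).hom else 0

lemma ι_π_of_ne {r : ZMod n} {j l : ℤ} (hj : (j : ZMod n) = r) (h : j ≠ l) :
    ι n X r j hj ≫ π X r l = 0 := by
  rw [π, ι_desc, dif_neg h]

lemma ι_π_self {r : ZMod n} {j : ℤ} (hj : (j : ZMod n) = r) :
    ι n X r j hj ≫ π X r j = 𝟙 _ := by
  rw [π, ι_desc, dif_pos rfl]
  rfl

lemma d_π {r s : ZMod n} (hrs : r + 1 = s) {l m : ℤ} (hlm : l + 1 = m) :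
    ((compression R n).obj X).d r s ≫ π X s m = π X r l ≫ X.obj.d l m := by
  subst hlm
  refine hom_ext fun j hj => ?_
  rw [← Category.assoc, ι_d rfl hj (cast_add_one hrs hj), Category.assoc, ← Category.assoc (ι _ _ _ _ _)]
  by_cases h : j = l
  · subst h
    rw [ι_π_self, ι_π_self, Category.comp_id, Category.id_comp]
  · rw [ι_π_of_ne hj h, ι_π_of_ne _ (by omega), comp_zero, zero_comp]

lemma map_f_π (f : X ⟶ Y) (r : ZMod n) (l : ℤ) :
    ((compression R n).map f).f r ≫ π Y r l = π X r l ≫ f.hom.f l := by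
  refine hom_ext fun j hj => ?_
  rw [← Category.assoc, ι_map_f, Category.assoc, ← Category.assoc (ι _ _ _ _ _)]
  by_cases h : j = l
  · subst h
    rw [ι_π_self, ι_π_self, Category.comp_id, Category.id_comp]
  · rw [ι_π_of_ne hj h, ι_π_of_ne hj h, comp_zero, zero_comp]

lemma ι_XIsoOfEq {r s : ZMod n} (h : r = s) (j : ℤ) (hj : (j : ZMod n) = r) :
    ι n X r j hj ≫ (((compression R n).obj X).XIsoOfEq h).hom = ι n X s j (hj.trans h) := by
  subst h
  simp

end Compression

/-- The inclusion of the direct summand `Σ^{ni} X` in `UΔX`. -/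
noncomputable def compressionIncl (X : Cb.{v} R) (i : ℤ) :
    X.obj⟦(n : ℤ) * i⟧ ⟶ (unroll _ n).obj ((compression R n).obj X) :=
  (compressionUnit n X)⟦(n : ℤ) * i⟧' ≫ (unrollPeriod n i).app _

lemma compressionIncl_f (X : Cb.{v} R) (i j : ℤ) :
    (compressionIncl (n := n) X i).f j =
      (show X.obj.X (j + n * i) ⟶ ((compression R n).obj X).X (j : ZMod n) from
        periodSign n i j • Compression.ι n X (j : ZMod n) (j + n * i) (cast_add_mul_eq n i j)) := by
  have := Compression.ι_XIsoOfEq (X := X) (cast_add_mul_eq n i j) (j + n * i) rfl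
  rw [← this, ← Linear.comp_units_smul]
  rfl

/-- The projection of `UΔX` to the direct summand `Σ^{ni} X`. -/
noncomputable def compressionProj (X : Cb.{v} R) (i : ℤ) :
    (unroll _ n).obj ((compression R n).obj X) ⟶ X.obj⟦(n : ℤ) * i⟧ where
  f j := show ((compression R n).obj X).X (j : ZMod n) ⟶ X.obj.X (j + n * i) from
    periodSign n i j • Compression.π X (j : ZMod n) (j + n * i)
  comm' j l hjl := by
    have hjl : j + 1 = l := hjl
    subst hjl
    rw [unroll_d _ rfl]
    change (periodSign n i j • Compression.π X (j : ZMod n) (j + n * i)) ≫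
      (((n : ℤ) * i).negOnePow • X.obj.d (j + n * i) (j + 1 + n * i)) =
      _ ≫ (periodSign n i (j + 1) • Compression.π X ((j + 1 : ℤ) : ZMod n) (j + 1 + n * i))
    rw [Linear.units_smul_comp, Linear.comp_units_smul, Linear.comp_units_smul,
      Compression.d_π (rel_cast rfl) (show j + n * i + 1 = j + 1 + n * i by ring), smul_smul,
      periodSign_succ, mul_comm (periodSign n i j)]

lemma compressionProj_f (X : Cb.{v} R) (i j : ℤ) :
    (compressionProj (n := n) X i).f j =
      (show ((compression R n).obj X).X (j : ZMod n) ⟶ X.obj.X (j + n * i) from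
        periodSign n i j • Compression.π X (j : ZMod n) (j + n * i)) := rfl

lemma compressionProj_naturality {X Y : Cb.{v} R} (f : X ⟶ Y) (i : ℤ) :
    (unroll _ n).map ((compression R n).map f) ≫ compressionProj Y i =
      compressionProj X i ≫ f.hom⟦(n : ℤ) * i⟧' := by
  ext j : 1
  change ((compression R n).map f).f (j : ZMod n) ≫ (periodSign n i j • Compression.π Y _ _) =
    (periodSign n i j • Compression.π X _ _) ≫ f.hom.f (j + n * i)
  rw [Linear.units_smul_comp, Linear.comp_units_smul, Compression.map_f_π]

lemma compressionIncl_naturality {X Y : Cb.{v} R} (f : X ⟶ Y) (i : ℤ) :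
    compressionIncl X i ≫ (unroll _ n).map ((compression R n).map f) =
      f.hom⟦(n : ℤ) * i⟧' ≫ compressionIncl Y i := by
  rw [compressionIncl, compressionIncl, Category.assoc, ← NatTrans.naturality, Functor.comp_map,
    ← Category.assoc, ← Functor.map_comp, compressionUnit_naturality, Functor.map_comp,
    Category.assoc]

lemma compressionIncl_proj_self (X : Cb.{v} R) (i : ℤ) :
    compressionIncl (n := n) X i ≫ compressionProj X i = 𝟙 _ := by
  ext j : 1
  rw [HomologicalComplex.comp_f, compressionIncl_f, compressionProj_f]
  change (periodSign n i j • _) ≫ (periodSign n i j • Compression.π X _ _) = 𝟙 (X.obj.X _)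
  rw [Linear.units_smul_comp, Linear.comp_units_smul, Compression.ι_π_self, smul_smul,
    Int.units_mul_self, one_smul]

lemma compressionIncl_proj_of_ne (hn : 1 ≤ n) (X : Cb.{v} R) {i k : ℤ} (h : i ≠ k) :
    compressionIncl (n := n) X i ≫ compressionProj X k = 0 := by
  ext j : 1
  rw [HomologicalComplex.comp_f, compressionIncl_f, compressionProj_f]
  change (periodSign n i j • (show X.obj.X (j + n * i) ⟶ _ from Compression.ι n X _ _ _)) ≫
    (periodSign n k j • Compression.π X _ _) = (0 : X.obj.X (j + n * i) ⟶ X.obj.X (j + n * k))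
  have hn' : (n : ℤ) ≠ 0 := by omega
  have hne : j + n * i ≠ j + n * k := fun h' => h (mul_left_cancel₀ hn' (by linarith))
  rw [Linear.units_smul_comp, Linear.comp_units_smul, Compression.ι_π_of_ne _ hne, smul_zero,
    smul_zero]

lemma sum_compressionProj_incl_f (hn : 1 ≤ n) (X : Cb.{v} R) (S : Finset ℤ) (j : ℤ)
    (hS : ∀ i ∉ S, IsZero (X.obj.X (j + n * i))) :
    (∑ i ∈ S, compressionProj (n := n) X i ≫ compressionIncl X i).f j = 𝟙 _ := by
  have hterm (i : ℤ) : (compressionProj (n := n) X i ≫ compressionIncl X i).f j =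
      Compression.π X (j : ZMod n) (j + n * i) ≫
        Compression.ι n X (j : ZMod n) (j + n * i) (cast_add_mul_eq n i j) := by
    rw [HomologicalComplex.comp_f, compressionIncl_f, compressionProj_f]
    change (periodSign n i j • Compression.π X _ _) ≫ (periodSign n i j • _) = _
    rw [Linear.units_smul_comp, Linear.comp_units_smul, smul_smul, Int.units_mul_self, one_smul]
  refine ((HomologicalComplex.eval _ _ j).map_sum _ _).trans ?_
  refine (Finset.sum_congr rfl fun i _ => hterm i).trans ?_
  refine Compression.hom_ext fun l hl => ?_
  obtain ⟨i, hi⟩ : (n : ℤ) ∣ l - j := (ZMod.intCast_eq_intCast_iff_dvd_sub _ _ _).1 hl.symm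
  obtain rfl : l = j + n * i := by omega
  have hn' : (n : ℤ) ≠ 0 := by omega
  rw [Preadditive.comp_sum, Finset.sum_eq_single i]
  · rw [← Category.assoc, Compression.ι_π_self]
    exact (Category.id_comp _).trans (Category.comp_id _).symm
  · intro k _ hk
    have hne : j + n * i ≠ j + n * k := fun h' => hk (mul_left_cancel₀ hn' (by linarith))
    rw [← Category.assoc, Compression.ι_π_of_ne _ hne, zero_comp]
  · intro hi
    exact (hS i hi).eq_of_src _ _

/-- For complexes concentrated in bounded ranges of degrees, only finitely many of the shifts
`Σ^{ni}` of the second complex have a degree in common with the first one. -/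
lemma exists_finset_isZero (hn : 1 ≤ n) (X : Cb.{v} R) (a b : ℤ) :
    ∃ S₀ : Finset ℤ, ∀ S, S₀ ⊆ S → ∀ j, a ≤ j → j ≤ b → ∀ i ∉ S,
      IsZero (X.obj.X (j + n * i)) := by
  obtain ⟨c, d, _, _⟩ := X.property
  refine ⟨Finset.Icc (-(|a| + |b| + |c| + |d|)) (|a| + |b| + |c| + |d|), ?_⟩
  intro S hS j ha hb i hi
  have hi' : i ∉ Finset.Icc _ _ := fun h => hi (hS h)
  rw [Finset.mem_Icc, not_and_or, not_le, not_le] at hi'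
  have hn' : (1 : ℤ) ≤ n := by exact_mod_cast hn
  have ha' := neg_abs_le a
  have hb' := le_abs_self b
  have hc' := neg_abs_le c
  have hd' := le_abs_self d
  have h₀ : 0 ≤ |a| ∧ 0 ≤ |b| ∧ 0 ≤ |c| ∧ 0 ≤ |d| := by simp
  rcases hi' with h | h
  · have : (n : ℤ) * i ≤ i := by nlinarith
    exact X.obj.isZero_of_isStrictlyGE c _ (by omega)
  · have : i ≤ (n : ℤ) * i := by nlinarith
    exact X.obj.isZero_of_isStrictlyLE d _ (by omega)

/-! ### Compression preserves quasi-isomorphisms -/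

lemma HomologicalComplex.homologyMap_congr_of_f_eq {C ι : Type*} [Category* C]
    [HasZeroMorphisms C] {c : ComplexShape ι} {K L : HomologicalComplex C c} {f g : K ⟶ L} {i : ι}
    [K.HasHomology i] [L.HasHomology i] (h : f.f i = g.f i) :
    homologyMap f i = homologyMap g i := by
  rw [← cancel_epi (K.homologyπ i), homologyπ_naturality, homologyπ_naturality]
  congr 1
  rw [← cancel_mono (L.iCycles i), cyclesMap_i, cyclesMap_i, h]

lemma quasiIso_compression_map [IsNoetherianRing R] (hn : 1 ≤ n) {X Y : Cb.{u} R} (f : X ⟶ Y)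
    (hf : QuasiIso f.hom) : QuasiIso ((compression R n).map f) := by
  rw [← quasiIso_unroll_map_iff, quasiIso_iff]
  intro j
  rw [quasiIsoAt_iff_isIso_homologyMap]
  obtain ⟨S₁, hS₁⟩ := exists_finset_isZero hn X j j
  obtain ⟨S₂, hS₂⟩ := exists_finset_isZero hn Y j j
  have hX := sum_compressionProj_incl_f hn X (S₁ ∪ S₂) j
    (hS₁ _ Finset.subset_union_left j le_rfl le_rfl)
  have hY := sum_compressionProj_incl_f hn Y (S₁ ∪ S₂) j
    (hS₂ _ Finset.subset_union_right j le_rfl le_rfl)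
  let H := HomologicalComplex.homologyFunctor (FGModuleCat.{u} R) (ComplexShape.up ℤ) j
  have hid {Z : CochainComplex (FGModuleCat.{u} R) ℤ} (φ : Z ⟶ Z) (h : φ.f j = 𝟙 _) :
      H.map φ = 𝟙 _ :=
    (HomologicalComplex.homologyMap_congr_of_f_eq h).trans (H.map_id Z)
  have hf' (i : ℤ) : IsIso (H.map (f.hom⟦(n : ℤ) * i⟧')) := by
    have : QuasiIso (f.hom⟦(n : ℤ) * i⟧') := inferInstance
    exact inferInstanceAs (IsIso (HomologicalComplex.homologyMap _ j))
  suffices IsIso (H.map ((unroll _ n).map ((compression R n).map f))) from this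
  refine ⟨∑ i ∈ S₁ ∪ S₂, H.map (compressionProj Y i) ≫ inv (H.map (f.hom⟦(n : ℤ) * i⟧')) ≫
    H.map (compressionIncl X i), ?_, ?_⟩
  · refine Eq.trans ?_ (hid _ hX)
    rw [H.map_sum]
    refine (Preadditive.comp_sum _ _ _).trans (Finset.sum_congr rfl fun i _ => ?_)
    rw [← Category.assoc, ← H.map_comp, compressionProj_naturality, H.map_comp, H.map_comp,
      Category.assoc, IsIso.hom_inv_id_assoc]
  · refine Eq.trans ?_ (hid _ hY)
    rw [H.map_sum]
    refine (Preadditive.sum_comp _ _ _).trans (Finset.sum_congr rfl fun i _ => ?_)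
    rw [Category.assoc, Category.assoc, ← H.map_comp, compressionIncl_naturality, H.map_comp,
      H.map_comp, IsIso.inv_hom_id_assoc]

end Decomposition

/-! ### Bounded projective resolutions -/

section BoundedProjective

variable {C : Type u} [Category.{v} C] [Abelian C]

lemma isStrictlyLE_mappingCone {K L : CochainComplex C ℤ} (f : K ⟶ L) (a b c : ℤ)
    [K.IsStrictlyLE a] [L.IsStrictlyLE b] (ha : a ≤ c + 1) (hb : b ≤ c) :
    (CochainComplex.mappingCone f).IsStrictlyLE c := by
  rw [CochainComplex.isStrictlyLE_iff]
  intro i hi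
  rw [CochainComplex.mappingCone.isZero_X_iff]
  exact ⟨K.isZero_of_isStrictlyLE a _ (by omega), L.isZero_of_isStrictlyLE b _ (by omega)⟩

lemma projective_mappingCone_X {K L : CochainComplex C ℤ} (f : K ⟶ L)
    (hK : ∀ j, Projective (K.X j)) (hL : ∀ j, Projective (L.X j)) (j : ℤ) :
    Projective ((CochainComplex.mappingCone f).X j) := by
  have := hK (j + 1)
  have := hL j
  have h : (ComplexShape.up ℤ).Rel j (j + 1) := rfl
  exact Projective.of_iso (HomologicalComplex.homotopyCofiber.XIsoBiprod f j (j + 1) h).symm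
    inferInstance

variable [HasDerivedCategory C]

variable (C) in
/-- The objects of the derived category of `C` which are isomorphic to a bounded complex of
projective objects of `C`. -/
def boundedProjectives : ObjectProperty (DerivedCategory C) := fun X =>
  ∃ (P : CochainComplex C ℤ) (a b : ℤ), P.IsStrictlyGE a ∧ P.IsStrictlyLE b ∧
    (∀ j, Projective (P.X j)) ∧ Nonempty (DerivedCategory.Q.obj P ≅ X)

instance : (boundedProjectives C).IsClosedUnderIsomorphisms where
  of_iso := by
    rintro X Y e ⟨P, a, b, ha, hb, hP, ⟨e'⟩⟩
    exact ⟨P, a, b, ha, hb, hP, ⟨e' ≪≫ e⟩⟩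

instance : (boundedProjectives C).IsStableUnderShift ℤ where
  isStableUnderShiftBy m := ⟨by
    rintro X ⟨P, a, b, _, _, hP, ⟨e⟩⟩
    exact ⟨P⟦m⟧, a - m, b - m, P.isStrictlyGE_shift a m _ (by ring),
      P.isStrictlyLE_shift b m _ (by ring), fun j => hP _,
      ⟨((DerivedCategory.Q (C := C)).commShiftIso m).app P ≪≫ (shiftFunctor _ m).mapIso e⟩⟩⟩

/-- The cone of a morphism between bounded complexes of projectives is again such a complex, since
the morphism is represented by a chain map. -/
instance : (boundedProjectives C).IsTriangulatedClosed₃ := by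
  refine ObjectProperty.IsTriangulatedClosed₃.mk' ?_
  rintro T hT ⟨K, a, b, _, _, hK, ⟨e⟩⟩ ⟨L, a', b', _, _, hL, ⟨e'⟩⟩
  have := CochainComplex.isKProjective_of_projective K b
  obtain ⟨f, hf⟩ := CochainComplex.IsKProjective.Q_map_surjective K L
    (e.hom ≫ T.mor₁ ≫ e'.inv)
  have hcone := DerivedCategory.mappingCone_triangle_distinguished f
  have i := Pretriangulated.isoTriangleOfIso₁₂ _ _ hcone hT e e'
    (show DerivedCategory.Q.map f ≫ e'.hom = e.hom ≫ T.mor₁ by simp [hf])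
  refine ⟨CochainComplex.mappingCone f, min (a - 1) a', max b b',
    CochainComplex.isStrictlyGE_mappingCone f a a' _ (by omega) (by omega),
    isStrictlyLE_mappingCone f b b' _ (by omega) (by omega),
    projective_mappingCone_X f hK hL, ⟨(Pretriangulated.Triangle.π₃.mapIso i)⟩⟩

instance : (boundedProjectives C).IsTriangulatedClosed₂ :=
  ObjectProperty.IsTriangulatedClosed₂.of_isTriangulatedClosed₃

lemma boundedProjectives_singleFunctor (P : C) [Projective P] :
    boundedProjectives C ((DerivedCategory.singleFunctor C 0).obj P) := by
  refine ⟨(CochainComplex.singleFunctor C 0).obj P, 0, 0, inferInstance, inferInstance,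
    fun j => ?_, ⟨((DerivedCategory.singleFunctorIsoCompQ C 0).app P).symm⟩⟩
  by_cases hj : j = 0
  · subst hj
    exact Projective.of_iso (HomologicalComplex.singleObjXSelf (ComplexShape.up ℤ) 0 P).symm
      inferInstance
  · exact (HomologicalComplex.isZero_single_obj_X (ComplexShape.up ℤ) 0 P j hj).projective

/-- By truncation, every bounded object is an iterated extension of shifts of objects of `C`. -/
lemma boundedProjectives_of_isGE_of_isLE
    (h : ∀ M : C, boundedProjectives C ((DerivedCategory.singleFunctor C 0).obj M))
    (a : ℤ) (d : ℕ) (X : DerivedCategory C) (_ : X.IsGE a) (_ : X.IsLE (a + d - 1)) :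
    boundedProjectives C X := by
  induction d generalizing X with
  | zero =>
    have h₀ : IsZero X := DerivedCategory.TStructure.t.isZero X (a + (0 : ℕ) - 1) a (by simp)
    have h₁ := (DerivedCategory.singleFunctor C 0).map_isZero (isZero_zero C)
    exact (boundedProjectives C).prop_of_iso (h₁.iso h₀) (h _)
  | succ d ih =>
    let t := DerivedCategory.TStructure.t (C := C)
    have hle : X.IsLE (a + d) := by convert! (inferInstance : X.IsLE (a + (d + 1 : ℕ) - 1)) using 1; push_cast; ring
    let Y := (t.truncGT (a + d - 1)).obj X
    have hY : Y.IsGE (a + d) := inferInstanceAs (t.IsGE ((t.truncGT (a + d - 1)).obj X) (a + d))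
    have hY' : Y.IsLE (a + d) := inferInstanceAs (t.IsLE ((t.truncGT (a + d - 1)).obj X) (a + d))
    obtain ⟨M, ⟨e⟩⟩ := DerivedCategory.exists_iso_singleFunctor_obj_of_isGE_of_isLE Y (a + d)
    let e' : Y ≅ ((DerivedCategory.singleFunctor C 0).obj M)⟦-(a + d)⟧ := e ≪≫
      (((DerivedCategory.singleFunctors C).shiftIso (-(a + d)) (a + d) 0 (by ring)).app M).symm
    refine (boundedProjectives C).ext_of_isTriangulatedClosed₂ _
      (t.triangleLEGT_distinguished (a + d - 1) X)
      (ih _ (inferInstanceAs (t.IsGE ((t.truncLE (a + d - 1)).obj X) a))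
        (inferInstanceAs (t.IsLE ((t.truncLE (a + d - 1)).obj X) (a + d - 1))))
      ((boundedProjectives C).prop_of_iso e'.symm ((boundedProjectives C).le_shift _ _ (h M)))

end BoundedProjective

section FiniteGlobalDimension

variable {R : Type u} [Ring R]

lemma FGModuleCat.projective_of_projective_obj [IsNoetherianRing R] (M : FGModuleCat.{u} R)
    [Projective M.obj] :
    Projective M :=
  (forget₂ (FGModuleCat.{u} R) (ModuleCat.{u} R)).projective_of_map_projective
    (inferInstanceAs (Projective M.obj))

/-- The presentation of a finitely generated module by a finitely generated free module. -/
lemma FGModuleCat.exists_shortExact [IsNoetherianRing R] (M : FGModuleCat.{u} R) :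
    ∃ S : ShortComplex (FGModuleCat.{u} R), S.ShortExact ∧ Projective S.X₂.obj ∧ S.X₃ = M := by
  obtain ⟨m, f, hf⟩ := Module.Finite.exists_fin' R M
  let F : FGModuleCat.{u} R := FGModuleCat.of R (Fin m → R)
  let φ : F ⟶ M := ObjectProperty.homMk (ModuleCat.ofHom f)
  have hφ : Epi φ := by
    refine (forget₂ (FGModuleCat.{u} R) (ModuleCat.{u} R)).epi_of_epi_map ?_
    exact (ModuleCat.epi_iff_surjective (ModuleCat.ofHom f)).2 hf
  refine ⟨ShortComplex.mk (kernel.ι φ) φ (kernel.condition φ),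
    { exact := ShortComplex.exact_kernel φ }, ?_, rfl⟩
  exact ModuleCat.projective_of_free (Pi.basisFun R (Fin m))

/-- Dimension shifting: a finitely generated module of finite projective dimension has a bounded
resolution by finitely generated projective modules. -/
lemma boundedProjectives_singleFunctor_of_hasProjectiveDimensionLE [IsNoetherianRing R] (d : ℕ)
    (M : FGModuleCat.{u} R) (hM : HasProjectiveDimensionLE M.obj d) :
    boundedProjectives _ ((DerivedCategory.singleFunctor (FGModuleCat.{u} R) 0).obj M) := by
  induction d generalizing M with
  | zero =>
    have := (projective_iff_hasProjectiveDimensionLE_zero _).2 hM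
    have := FGModuleCat.projective_of_projective_obj M
    exact boundedProjectives_singleFunctor M
  | succ d ih =>
    obtain ⟨S, hS, h₂, rfl⟩ := FGModuleCat.exists_shortExact M
    have := FGModuleCat.projective_of_projective_obj S.X₂
    have hS' := hS.map_of_exact (forget₂ (FGModuleCat.{u} R) (ModuleCat.{u} R))
    refine (boundedProjectives _).ext_of_isTriangulatedClosed₃ _ hS.singleTriangle_distinguished
      (ih S.X₁ ((hS'.hasProjectiveDimensionLT_X₃_iff d h₂).1 hM))
      (boundedProjectives_singleFunctor S.X₂)

/-- Over a noetherian ring of finite global dimension, every object of `D^b(mod R)` has a bounded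
resolution by finitely generated projective modules. -/
lemma exists_bounded_projective_resolution [IsNoetherianRing R] (hR : HasFiniteGlobalDimension R)
    (X : Db R) :
    ∃ P : Cb.{u} R, (∀ j, Projective (P.obj.X j)) ∧
      Nonempty (DerivedCategory.Q.obj P.obj ≅ X.obj) := by
  obtain ⟨d, hd⟩ := hR
  obtain ⟨⟨a, ha⟩, ⟨b, hb⟩⟩ := X.property
  have ha' : X.obj.IsGE a := ha
  have hb' : X.obj.IsLE b := hb
  obtain ⟨P, a', b', ha', hb', hP, h⟩ := boundedProjectives_of_isGE_of_isLE
    (fun M => boundedProjectives_singleFunctor_of_hasProjectiveDimensionLE d M (hd M.obj))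
    a (b - a + 1).toNat X.obj ha
    (DerivedCategory.TStructure.t.isLE_of_le X.obj b _ (by have := Int.self_le_toNat (b - a + 1); omega))
  exact ⟨⟨P, a', b', ha', hb'⟩, hP, h⟩

end FiniteGlobalDimension

/-! ### The functor on the orbit category -/

section CompressionFunctor

open PeriodicComplex

variable {R : Type u} [Ring R] [IsNoetherianRing R] {n : ℕ}

lemma Cb.isKProjective (P : Cb.{u} R) (hP : ∀ j, Projective (P.obj.X j)) : P.obj.IsKProjective := by
  obtain ⟨a, b, _, _⟩ := P.property
  exact CochainComplex.isKProjective_of_projective P.obj b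

/-- The unit `X ⟶ UΔX` is a universal arrow from `X` to the unrolling functor
`U : D_n(mod R) ⥤ D(mod R)`, for every bounded complex `X`: this may be checked on a bounded
projective resolution of `X`, since compression preserves quasi-isomorphisms. -/
lemma compressionUnitQ_bijective (hn : 1 ≤ n) (hR : HasFiniteGlobalDimension R) (X : Cb.{u} R)
    (M : Dn R n) :
    Function.Bijective fun g : (CnToDn R n).obj ((compression R n).obj X) ⟶ M =>
      compressionUnitQ n X ≫ (unrollDn R n).map g := by
  obtain ⟨P, hP, ⟨e⟩⟩ := exists_bounded_projective_resolution hR ((CbToDb R).obj X)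
  change DerivedCategory.Q.obj P.obj ≅ DerivedCategory.Q.obj X.obj at e
  have := P.isKProjective hP
  obtain ⟨s, hs⟩ := CochainComplex.IsKProjective.Q_map_surjective P.obj X.obj e.hom
  let f : P ⟶ X := ObjectProperty.homMk s
  have hf : QuasiIso f.hom :=
    (DerivedCategory.isIso_Q_map_iff_quasiIso _ _).1 (by
      change IsIso (DerivedCategory.Q.map s)
      rw [hs]
      infer_instance)
  have := quasiIso_compression_map hn f hf
  have := isIso_CnToDn_map ((compression R n).map f)
  have hb := compressionUnitQ_bijective_of_isKProjective (n := n) P M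
  have key (g : (CnToDn R n).obj ((compression R n).obj X) ⟶ M) :
      compressionUnitQ n P ≫ (unrollDn R n).map
        ((CnToDn R n).map ((compression R n).map f) ≫ g) =
      e.hom ≫ compressionUnitQ n X ≫ (unrollDn R n).map g := by
    rw [Functor.map_comp, ← Category.assoc, compressionUnitQ_naturality, Category.assoc, ← hs]
    rfl
  constructor
  · intro g g' h
    rw [← cancel_epi ((CnToDn R n).map ((compression R n).map f))]
    refine hb.1 ?_
    dsimp only at h ⊢
    rw [key, key, h]
  · intro φ
    obtain ⟨g, hg⟩ := hb.2 (e.hom ≫ φ)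
    refine ⟨inv ((CnToDn R n).map ((compression R n).map f)) ≫ g, ?_⟩
    rw [← cancel_epi e.hom]
    refine (key _).symm.trans (Eq.trans ?_ hg)
    rw [IsIso.hom_inv_id_assoc]

lemma unrollDnPeriodicity_τ_app (i : ℤ) (M : PeriodicComplex (FGModuleCat.{u} R) n) :
    ((unrollDnPeriodicity R n).τ i).app ((CnToDn R n).obj M) =
      (show (DerivedCategory.Q.obj ((unroll _ n).obj M))⟦(n : ℤ) * i⟧ ⟶
          DerivedCategory.Q.obj ((unroll _ n).obj M) from
        ((DerivedCategory.Q (C := FGModuleCat.{u} R)).commShiftIso ((n : ℤ) * i)).inv.app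
          ((unroll _ n).obj M) ≫ DerivedCategory.Q.map ((unrollPeriod n i).app M)) :=
  unrollDnτ_app i M

/-- The unit `X ⟶ UΔX` followed by the periodicity `Σ^{ni} UΔX ⟶ UΔX` is the inclusion of the
direct summand `Σ^{ni} X`. -/
lemma compressionUnitQ_shift_comp_τ (X : Cb.{u} R) (i : ℤ) :
    (compressionUnitQ n X)⟦(n : ℤ) * i⟧' ≫ ((unrollDnPeriodicity R n).τ i).app _ =
      (show (DerivedCategory.Q.obj X.obj)⟦(n : ℤ) * i⟧ ⟶
          DerivedCategory.Q.obj ((unroll _ n).obj ((compression R n).obj X)) from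
        ((DerivedCategory.Q (C := FGModuleCat.{u} R)).commShiftIso ((n : ℤ) * i)).inv.app X.obj ≫
          DerivedCategory.Q.map (compressionIncl X i)) := by
  have h := ((DerivedCategory.Q (C := FGModuleCat.{u} R)).commShiftIso
    ((n : ℤ) * i)).inv.naturality (compressionUnit n X)
  dsimp only [Functor.comp_map] at h
  rw [unrollDnPeriodicity_τ_app, compressionIncl, Functor.map_comp]
  exact (Category.assoc _ _ _).symm.trans
    ((h =≫ DerivedCategory.Q.map ((unrollPeriod n i).app ((compression R n).obj X))).trans
      (Category.assoc _ _ _))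

section

variable (hR : HasFiniteGlobalDimension R)

/-- A bounded complex of finitely generated projective modules which represents a given object of
`D^b(mod R)`. -/
noncomputable def resolution (X : Db R) : Cb.{u} R :=
  (exists_bounded_projective_resolution hR X).choose

instance (X : Db R) : (resolution hR X).obj.IsKProjective :=
  Cb.isKProjective _ (exists_bounded_projective_resolution hR X).choose_spec.1

/-- The isomorphism in `D(mod R)` from the resolution of an object to the object. -/
noncomputable def resolutionIso (X : Db R) :
    DerivedCategory.Q.obj (resolution hR X).obj ≅
      (DerivedCategory.Bounded.ι (C := FGModuleCat.{u} R)).obj X :=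
  (exists_bounded_projective_resolution hR X).choose_spec.2.some

variable (n) in
/-- The universal arrows `X ≅ P ⟶ UΔP`, for `X` in `D^b(mod R)` and a bounded
projective resolution `P` of `X`. -/
noncomputable def compressionArrows :
    UniversalArrows (DerivedCategory.Bounded.ι (C := FGModuleCat.{u} R)) (unrollDn R n) where
  obj X := (CnToDn R n).obj ((compression R n).obj (resolution hR X))
  η X := (resolutionIso hR X).inv ≫ compressionUnitQ n (resolution hR X)
  bijective X M := by
    have h := compressionUnitQ_bijective_of_isKProjective (n := n) (resolution hR X) M
    constructor
    · intro g g' hg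
      dsimp only at hg
      rw [Category.assoc, Category.assoc, cancel_epi] at hg
      exact h.1 hg
    · intro φ
      obtain ⟨g, hg⟩ := h.2 ((resolutionIso hR X).hom ≫ φ)
      refine ⟨g, ?_⟩
      dsimp only at hg ⊢
      rw [Category.assoc, hg, Iso.inv_hom_id_assoc]

variable {X Y : Db R}

/-- The isomorphism from `Hom(X, Σ^{ni} Y)` to `Hom(X, Σ^{ni} Q)`, where `Q` is
the resolution of `Y`. -/
noncomputable def homShiftResolution (i : ℤ) (f : ShiftedHom X Y ((n : ℤ) * i)) :
    (DerivedCategory.Bounded.ι (C := FGModuleCat.{u} R)).obj X ⟶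
      DerivedCategory.Q.obj ((resolution hR Y).obj⟦(n : ℤ) * i⟧) :=
  f.map (DerivedCategory.Bounded.ι (C := FGModuleCat.{u} R)) ≫
    (resolutionIso hR Y).inv⟦(n : ℤ) * i⟧' ≫
    ((DerivedCategory.Q (C := FGModuleCat.{u} R)).commShiftIso ((n : ℤ) * i)).inv.app _

lemma homShiftResolution_bijective (i : ℤ) :
    Function.Bijective (homShiftResolution (n := n) hR (X := X) (Y := Y) i) := by
  let J := DerivedCategory.Bounded.ι (C := FGModuleCat.{u} R)
  let e : J.obj (Y⟦(n : ℤ) * i⟧) ≅ DerivedCategory.Q.obj ((resolution hR Y).obj⟦(n : ℤ) * i⟧) :=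
    (J.commShiftIso ((n : ℤ) * i)).app Y ≪≫
      (shiftFunctor _ ((n : ℤ) * i)).mapIso (resolutionIso hR Y).symm ≪≫
      ((DerivedCategory.Q (C := FGModuleCat.{u} R)).commShiftIso ((n : ℤ) * i)).symm.app _
  have h (f : ShiftedHom X Y ((n : ℤ) * i)) : homShiftResolution hR i f = J.map f ≫ e.hom := by
    simp [homShiftResolution, ShiftedHom.map, e, J]
  constructor
  · intro f g hfg
    rw [h, h, cancel_mono] at hfg
    exact J.map_injective hfg
  · intro φ
    obtain ⟨f, hf⟩ := J.map_surjective (φ ≫ e.inv)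
    exact ⟨f, by rw [h, hf, Category.assoc, e.inv_hom_id, Category.comp_id]⟩

lemma homShiftResolution_zero (i : ℤ) :
    homShiftResolution hR i (0 : ShiftedHom X Y ((n : ℤ) * i)) = 0 := by
  rw [homShiftResolution, ShiftedHom.map, Functor.map_zero, zero_comp, zero_comp]

lemma homShiftResolution_add (i : ℤ) (f g : ShiftedHom X Y ((n : ℤ) * i)) :
    homShiftResolution hR i (f + g) = homShiftResolution hR i f + homShiftResolution hR i g := by
  simp only [homShiftResolution, ShiftedHom.map_add, Preadditive.add_comp]

variable (n X Y) in
/-- The map `⨁ᵢ Hom(X, Σ^{ni} Y) ⟶ Hom(X, UΔQ)`, where `Q` is the resolution of `Y`, which defines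
the functor `D^b(mod R)/Σⁿ ⥤ D_n(mod R)` on morphisms. -/
noncomputable def orbitHomToUnroll :
    OrbitCategory.OrbitHom n X Y →+
      ((DerivedCategory.Bounded.ι (C := FGModuleCat.{u} R)).obj X ⟶
        DerivedCategory.Q.obj ((unroll _ n).obj ((compression R n).obj (resolution hR Y)))) :=
  (unrollDnPeriodicity R n).extend (DerivedCategory.Bounded.ι (C := FGModuleCat.{u} R))
    ((compressionArrows n hR).η Y)

lemma orbitHomToUnroll_of (i : ℤ) (f : ShiftedHom X Y ((n : ℤ) * i)) :
    orbitHomToUnroll n hR X Y (DirectSum.of (fun i : ℤ => ShiftedHom X Y ((n : ℤ) * i)) i f) =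
      homShiftResolution hR i f ≫
        DerivedCategory.Q.map (compressionIncl (n := n) (resolution hR Y) i) := by
  refine (ShiftPeriodicity.extend_of _ _ _ _ _).trans ?_
  rw [ShiftPeriodicity.extendHom, homShiftResolution]
  change _ ≫ ((resolutionIso hR Y).inv ≫ compressionUnitQ n (resolution hR Y))⟦(n : ℤ) * i⟧' ≫
    ((unrollDnPeriodicity R n).τ i).app
      ((CnToDn R n).obj ((compression R n).obj (resolution hR Y))) = _
  rw [Functor.map_comp, Category.assoc, compressionUnitQ_shift_comp_τ]
  simp only [Category.assoc]
  rfl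

lemma orbitHomToUnroll_injective (hn : 1 ≤ n) :
    Function.Injective (orbitHomToUnroll n hR X Y) := by
  -- the components of a morphism are recovered by projecting to the direct summands of `UΔQ`
  have key (k : ℤ) (f : OrbitCategory.OrbitHom n X Y) :
      orbitHomToUnroll n hR X Y f ≫
          DerivedCategory.Q.map (compressionProj (resolution hR Y) k) =
        homShiftResolution hR k (f k) := by
    induction f using DirectSum.induction_on with
    | zero =>
      rw [map_zero, zero_comp, DirectSum.zero_apply, homShiftResolution_zero]
    | add f g hf hg =>
      rw [map_add, Preadditive.add_comp, hf, hg, ← homShiftResolution_add]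
      rfl
    | of i f =>
      rw [orbitHomToUnroll_of, Category.assoc, ← Functor.map_comp]
      by_cases h : i = k
      · subst h
        rw [compressionIncl_proj_self, CategoryTheory.Functor.map_id, DirectSum.of_eq_same]
        exact Category.comp_id _
      · rw [compressionIncl_proj_of_ne hn _ h, Functor.map_zero, comp_zero,
          DirectSum.of_eq_of_ne _ _ _ (Ne.symm h), homShiftResolution_zero]
  intro f g hfg
  refine DFinsupp.ext fun k => (homShiftResolution_bijective hR k).1 ?_
  rw [← key, ← key, hfg]

lemma orbitHomToUnroll_surjective (hn : 1 ≤ n) :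
    Function.Surjective (orbitHomToUnroll n hR X Y) := by
  intro φ
  obtain ⟨c, d, _, _⟩ := (resolution hR X).property
  obtain ⟨a, ha⟩ := CochainComplex.IsKProjective.Q_map_surjective (resolution hR X).obj
    ((unroll _ n).obj ((compression R n).obj (resolution hR Y))) ((resolutionIso hR X).hom ≫ φ)
  obtain ⟨S, hS⟩ := exists_finset_isZero hn (resolution hR Y) c d
  have hsum : a = ∑ i ∈ S, (a ≫ compressionProj (resolution hR Y) i) ≫
      compressionIncl (resolution hR Y) i := by
    simp only [Category.assoc, ← Preadditive.comp_sum]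
    ext j : 1
    by_cases hj : c ≤ j ∧ j ≤ d
    · rw [HomologicalComplex.comp_f,
        sum_compressionProj_incl_f hn _ S j (hS S subset_rfl j hj.1 hj.2), Category.comp_id]
    · rcases not_and_or.1 hj with hj | hj
      · exact ((resolution hR X).obj.isZero_of_isStrictlyGE c j (by omega)).eq_of_src _ _
      · exact ((resolution hR X).obj.isZero_of_isStrictlyLE d j (by omega)).eq_of_src _ _
  choose f hf using fun i : ℤ => (homShiftResolution_bijective (n := n) hR (X := X) i).2
    ((resolutionIso hR X).inv ≫ DerivedCategory.Q.map (a ≫ compressionProj (resolution hR Y) i))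
  refine ⟨∑ i ∈ S, DirectSum.of (fun i : ℤ => ShiftedHom X Y ((n : ℤ) * i)) i (f i), ?_⟩
  rw [map_sum]
  refine (Finset.sum_congr rfl fun i _ => orbitHomToUnroll_of hR i _).trans ?_
  rw [← cancel_epi (resolutionIso hR X).hom]
  refine Eq.trans ?_ ha
  conv_rhs => rw [hsum, Functor.map_sum]
  rw [Preadditive.comp_sum]
  refine Finset.sum_congr rfl fun i _ => ?_
  rw [hf, Functor.map_comp _ (a ≫ _), Category.assoc, Iso.hom_inv_id_assoc]

end

end CompressionFunctor

/-! ### Comparison with the compression of complexes -/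

section Comparison

open PeriodicComplex

section

variable {R : Type u} [Ring R] {n : ℕ}

lemma Compression.eqToHom_ι {X : Cb.{v} R} {r : ZMod n} {l l' : ℤ} (h : l = l')
    (hl : (l : ZMod n) = r) (hl' : (l' : ZMod n) = r) :
    eqToHom (congrArg X.obj.X h) ≫ Compression.ι n X r l' hl' = Compression.ι n X r l hl := by
  subst h
  exact Category.id_comp _

/-- The canonical isomorphism `Δ(Σⁿ X) ⟶ ΔX` corresponds to the inclusion of the direct summand
`Σⁿ X` in `UΔX`. -/
lemma compressionUnit_shift_comp_map_compressionShift (X : Cb.{v} R) :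
    compressionUnit n (X.shift n) ≫ (unroll _ n).map (compressionShift n X) =
      eqToHom (by rw [mul_one]; rfl) ≫ compressionIncl (n := n) X 1 := by
  ext j : 1
  rw [HomologicalComplex.comp_f, HomologicalComplex.comp_f, compressionIncl_f,
    HomologicalComplex.eqToHom_f, periodSign_one]
  refine (compressionι_shiftHom n X (j : ZMod n) j rfl (by simp)).trans ?_
  refine Eq.trans ?_ (Linear.comp_units_smul (eqToHom _) _ _).symm
  exact congrArg (((n : ℤ) * j).negOnePow • ·)
    (Compression.eqToHom_ι (X := X) (show j + (n : ℤ) = j + n * 1 by ring) _ _).symm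

end

variable {R : Type u} [Ring R] [IsNoetherianRing R] {n : ℕ}

/-- The canonical isomorphism `CbToDbShift` becomes the identity of `Σ^m X` after the
shift isomorphisms are cancelled. The equality `m = m'` is needed for `m = n` and `m' = n * 1`. -/
lemma map_CbToDbShift_comp_commShiftIso (X : Cb.{u} R) {m m' : ℤ} (h : m = m') :
    ShiftedHom.map (CbToDbShift X m ≫ eqToHom (by rw [h]) :
        ShiftedHom _ ((CbToDb R).obj X) m') (DerivedCategory.Bounded.ι (C := FGModuleCat.{u} R)) ≫
      ((DerivedCategory.Q (C := FGModuleCat.{u} R)).commShiftIso m').inv.app X.obj =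
    DerivedCategory.Q.map (eqToHom (by rw [← h]; rfl) : (X.shift m).obj ⟶ X.obj⟦m'⟧) := by
  subst h
  let Q := DerivedCategory.Q (C := FGModuleCat.{u} R)
  let J := DerivedCategory.Bounded.ι (C := FGModuleCat.{u} R)
  have h₁ : CbToDbShift X m ≫ eqToHom rfl = CbToDbShift X m := Category.comp_id _
  have h₂ : J.map (CbToDbShift X m) ≫ (J.commShiftIso m).hom.app ((CbToDb R).obj X) =
      (Q.commShiftIso m).hom.app X.obj :=
    (Category.assoc _ _ _).trans
      ((congrArg ((Q.commShiftIso m).hom.app X.obj ≫ ·)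
        ((J.commShiftIso m).inv_hom_id_app ((CbToDb R).obj X))).trans (Category.comp_id _))
  rw [h₁]
  exact (congrArg (· ≫ (Q.commShiftIso m).inv.app X.obj) h₂).trans
    ((Iso.hom_inv_id_app _ _).trans (Q.map_id _).symm)

variable (hR : HasFiniteGlobalDimension R)

variable (n) in
/-- The functor `D^b(mod R)/Σⁿ ⥤ D_n(mod R)` induced by the compression of complexes. -/
noncomputable def orbitCompression : OrbitCategory (Db R) n ⥤ Dn R n :=
  (compressionArrows n hR).orbitFunctor (unrollDnPeriodicity R n)

lemma orbitCompression_full (hn : 1 ≤ n) : (orbitCompression n hR).Full :=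
  (compressionArrows n hR).orbitFunctor_full _ fun _ _ => orbitHomToUnroll_surjective hR hn

lemma orbitCompression_faithful (hn : 1 ≤ n) : (orbitCompression n hR).Faithful :=
  (compressionArrows n hR).orbitFunctor_faithful _ fun _ _ => orbitHomToUnroll_injective hR hn

/-- The comparison of the values at `X` of the functor on the orbit category and of compression:
both carry universal arrows from `X`. -/
noncomputable def orbitCompressionCompare (X : Cb.{u} R) :
    (orbitCompression n hR).obj ((OrbitCategory.proj _ n).obj ((CbToDb R).obj X)) ⟶
      (CnToDn R n).obj ((compression R n).obj X) :=
  (compressionArrows n hR).desc (X := (CbToDb R).obj X) (compressionUnitQ n X)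

lemma orbitCompressionCompare_naturality {X Y : Cb.{u} R} (f : X ⟶ Y) :
    (orbitCompression n hR).map ((OrbitCategory.proj _ n).map ((CbToDb R).map f)) ≫
        orbitCompressionCompare hR Y =
      orbitCompressionCompare hR X ≫ (CnToDn R n).map ((compression R n).map f) := by
  refine ((compressionArrows n hR).orbitFunctor_map_comp_desc _ _ _).trans
    (Eq.trans ?_ ((compressionArrows n hR).desc_comp _ _).symm)
  refine congrArg _ ((ShiftPeriodicity.extend_proj_map _ _ _ _).trans ?_)
  exact (compressionUnitQ_naturality f).symm

lemma orbitCompression_map_homOfDegreeOne (X : Cb.{u} R) :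
    (orbitCompression n hR).map (OrbitCategory.homOfDegreeOne (CbToDbShift X n)) ≫
        orbitCompressionCompare hR X =
      orbitCompressionCompare hR (X.shift n) ≫ (CnToDn R n).map (compressionShift n X) := by
  refine ((compressionArrows n hR).orbitFunctor_map_comp_desc _ _ _).trans
    (Eq.trans ?_ ((compressionArrows n hR).desc_comp _ _).symm)
  refine congrArg _ ((ShiftPeriodicity.extend_of _ _ _ _ _).trans ?_)
  refine Eq.trans ?_ (compressionUnitQ_map (compressionShift n X)).symm
  rw [compressionUnit_shift_comp_map_compressionShift, Functor.map_comp,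
    ← map_CbToDbShift_comp_commShiftIso X (mul_one (n : ℤ)).symm]
  refine Eq.trans ?_ (Category.assoc _ _ _).symm
  exact congrArg _ (compressionUnitQ_shift_comp_τ X 1)

/-- The functor on the orbit category agrees with compression on bounded complexes. -/
noncomputable def orbitCompressionIso (hn : 1 ≤ n) :
    CbToDb R ⋙ OrbitCategory.proj (Db R) n ⋙ orbitCompression n hR ≅
      compression R n ⋙ CnToDn R n :=
  NatIso.ofComponents (fun X =>
      haveI : IsIso (orbitCompressionCompare (n := n) hR X) :=
        (compressionArrows n hR).isIso_desc (X := (CbToDb R).obj X) _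
          (compressionUnitQ_bijective hn hR X)
      asIso (orbitCompressionCompare hR X))
    fun f => orbitCompressionCompare_naturality hR f

lemma gradable_orbitCompression_obj (X : OrbitCategory (Db R) n) :
    gradable R n ((orbitCompression n hR).obj X) :=
  ⟨resolution hR X.obj, ⟨Iso.refl _⟩⟩

lemma essSurj_lift_orbitCompression (hn : 1 ≤ n) :
    ((gradable R n).lift (orbitCompression n hR) (gradable_orbitCompression_obj hR)).EssSurj where
  mem_essImage := by
    rintro ⟨M, X, ⟨i⟩⟩
    exact ⟨(OrbitCategory.proj _ n).obj ((CbToDb R).obj X),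
      ⟨(gradable R n).ι.preimageIso ((orbitCompressionIso hR hn).app X ≪≫ i)⟩⟩

end Comparison

theorem lemma3 {k : Type v} {Λ : Type u} [Field k] [Ring Λ] [Algebra k Λ] [FiniteDimensional k Λ]
    (hΛ : HasFiniteGlobalDimension Λᵐᵒᵖ) (n : ℕ) (hn : 1 ≤ n) :
    haveI : IsNoetherianRing Λᵐᵒᵖ := isNoetherianRing_mulOpposite k Λ
    ∃ (Δ : OrbitCategory (Db Λᵐᵒᵖ) n ⥤ Dn Λᵐᵒᵖ n)
      (e : CbToDb Λᵐᵒᵖ ⋙ OrbitCategory.proj (Db Λᵐᵒᵖ) n ⋙ Δ ≅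
        compression Λᵐᵒᵖ n ⋙ CnToDn Λᵐᵒᵖ n),
      (∀ X : Cb.{u} Λᵐᵒᵖ,
        Δ.map (OrbitCategory.homOfDegreeOne (CbToDbShift X n)) ≫ e.hom.app X =
          e.hom.app (X.shift n) ≫ (CnToDn Λᵐᵒᵖ n).map (compressionShift n X)) ∧
      Δ.Full ∧ Δ.Faithful ∧
      ∃ h : ∀ X, gradable Λᵐᵒᵖ n (Δ.obj X), ((gradable Λᵐᵒᵖ n).lift Δ h).IsEquivalence := by
  have : IsNoetherianRing Λᵐᵒᵖ := isNoetherianRing_mulOpposite k Λ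
  have hfull := orbitCompression_full hΛ hn
  have hfaithful := orbitCompression_faithful hΛ hn
  have := essSurj_lift_orbitCompression hΛ hn
  exact ⟨orbitCompression n hΛ, orbitCompressionIso hΛ hn,
    orbitCompression_map_homOfDegreeOne hΛ, hfull, hfaithful, gradable_orbitCompression_obj hΛ, { }⟩
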